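/- Let $\mathbb{K}$ be a field of characteristic $0$, and let $\mathbf{A}$ be the $\mathbb{K}$-linear category of Jacobi diagrams in handlebodies (Habiro--Massuyeau). Its objects are the non-negative integers. The space $\mathbf{A}(m,n)$ is spanned by the $(m,n)$-Jacobi diagrams modulo the STU relation. Such a diagram is a uni-trivalent graph with oriented trivalent vertices whose univalent vertices lie on the $n$ oriented arcs of $X_n$, and each of whose connected components has a univalent vertex; it is mapped together with $X_n$ into the handlebody $U_m$ of genus $m$ and is considered up to homotopy relative to the endpoints of $X_n$. The composition $D'\circ D$ is given by stacking a suitable cabling of $D$ on top of $D'$. The degree of a Jacobi diagram is half the number of its vertices. An $\mathbf{A}$-module is a $\mathbb{K}$-linear functor from $\mathbf{A}$ to $\mathbb{K}$-vector spaces. For $d\ge 0$ let $\mathbf{A}_{\ge d}(0,-)\subset\mathbf{A}(0,-)$ be the $\mathbf{A}$-submodule whose value at $n$ is the subspace of $\mathbf{A}(0,n)$ spanned by the Jacobi diagrams of degree at least $d$. An $\mathbf{A}$-module is called indecomposable if it is nonzero and is not the direct sum of two nonzero $\mathbf{A}$-submodules. **Theorem.** For all integers $d\ge 0$ and $d'\ge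 d+2$, the quotient $\mathbf{A}$-module $\mathbf{A}_{\ge d}(0,-)/\mathbf{A}_{\ge d'}(0,-)$ is indecomposable. -/

import Mathlib

/-!
Jacobi diagrams in handlebodies, the spaces they span modulo the STU relation, their composition by
stacking and cabling, and the degree filtration.

The handlebody `U_m` is a classifying space of the free group on `x_0, …, x_{m-1}`, where `x_i` is the
passage through the `i`-th handle. All end points of `X_n` lie on one contractible piece of `U_m`.
So a map of `X_n` together with a uni-trivalent graph to `U_m`, up to homotopy relative to the end
points of `X_n`, is given by the sequence of passages through handles along each arc and along each
edge, up to free reduction and up to moving a vertex of the graph through a handle.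
-/

namespace JacobiHandlebody

open Relation

/-- A passage through a handle: `(i, true)` is `x_i`, and `(i, false)` is its inverse. -/
abbrev Letter (m : ℕ) := Fin m × Bool

/-- What is met along an arc of `X_n`: a univalent vertex (named by its half-edge), or a passage
through a handle. -/
inductive Item (m : ℕ) : Type
  | leg (h : ℕ) : Item m
  | pass (x : Letter m) : Item m

/-- An edge: its two half-edges, and between them the word of handles met on the way from the first
half-edge to the second. -/
abbrev Edge (m : ℕ) := ℕ × List (Letter m) × ℕ

/-- The univalent vertices on (a part of) an arc, in order. -/
def legNames {m : ℕ} (L : List (Item m)) : List ℕ :=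
  L.filterMap fun
    | Item.leg h => some h
    | Item.pass _ => none

/-- The half-edges at a trivalent vertex. -/
def triNames (t : ℕ × ℕ × ℕ) : Multiset ℕ := {t.1, t.2.1, t.2.2}

/-- The two half-edges of an edge. -/
def edgeNames {m : ℕ} (e : Edge m) : Multiset ℕ := {e.1, e.2.2}

/-- The data of a uni-trivalent graph on `n` arcs in the handlebody of genus `m`. Half-edges are
named by natural numbers. `arc j` lists what is met along the `j`-th arc, following its orientation;
`tri` lists the trivalent vertices, each as its three half-edges in cyclic order; `edge` lists the
edges. -/
@[ext] structure RawDiagram (m n : ℕ) where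
  arc : Fin n → List (Item m)
  tri : List (ℕ × ℕ × ℕ)
  edge : List (Edge m)

namespace RawDiagram

variable {m n p : ℕ}

/-- The half-edges at univalent vertices. -/
def legs (D : RawDiagram m n) : Multiset ℕ := ∑ j, (legNames (D.arc j) : Multiset ℕ)

/-- The half-edges at trivalent vertices. -/
def triHalf (D : RawDiagram m n) : Multiset ℕ := (D.tri.map triNames).sum

/-- The half-edges that occur in edges. -/
def edgeHalf (D : RawDiagram m n) : Multiset ℕ := (D.edge.map edgeNames).sum

/-- Two half-edges belong to the same edge or to the same trivalent vertex. -/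
def Linked (D : RawDiagram m n) (h k : ℕ) : Prop :=
  (∃ e ∈ D.edge, h ∈ edgeNames e ∧ k ∈ edgeNames e) ∨
    ∃ t ∈ D.tri, h ∈ triNames t ∧ k ∈ triNames t

/-- The data form a Jacobi diagram: every half-edge lies at exactly one vertex and on exactly one
edge, and every connected component of the graph has a univalent vertex. -/
structure IsJacobi (D : RawDiagram m n) : Prop where
  nodup : (D.legs + D.triHalf).Nodup
  matched : D.edgeHalf = D.legs + D.triHalf
  anchored : ∀ h ∈ D.edgeHalf, ∃ l ∈ D.legs, ReflTransGen D.Linked h l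

/-- Renaming of the half-edges. -/
def renameItem (f : ℕ → ℕ) : Item m → Item m
  | Item.leg h => Item.leg (f h)
  | Item.pass x => Item.pass x

def renameTri (f : ℕ → ℕ) (t : ℕ × ℕ × ℕ) : ℕ × ℕ × ℕ := (f t.1, f t.2.1, f t.2.2)

def renameEdge (f : ℕ → ℕ) (e : Edge m) : Edge m := (f e.1, e.2.1, f e.2.2)

def rename (f : ℕ → ℕ) (D : RawDiagram m n) : RawDiagram m n where
  arc j := (D.arc j).map (renameItem f)
  tri := D.tri.map (renameTri f)
  edge := D.edge.map (renameEdge f)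

/-- The effect on the word of an edge of dragging through a handle, along `x`, the vertex at which
the half-edges in `s` are attached. -/
def dragEdge (x : Letter m) (s : Finset ℕ) (e : Edge m) : Edge m :=
  (e.1, (if e.1 ∈ s then [(x.1, !x.2)] else []) ++ e.2.1 ++ (if e.2.2 ∈ s then [x] else []), e.2.2)

/-- The elementary identifications between Jacobi diagrams in a handlebody. The first four express
that the names of the half-edges, the order in which vertices and edges are listed, the direction in
which an edge is written and the point at which a cyclic order is cut open are immaterial. The last
four generate homotopy in the handlebody relative to the end points of the arcs. -/
inductive Move : RawDiagram m n → RawDiagram m n → Prop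
  | rename (D : RawDiagram m n) (f : ℕ → ℕ) (hf : Function.Injective f) : Move D (D.rename f)
  | perm (arc : Fin n → List (Item m)) {t t' : List (ℕ × ℕ × ℕ)} {e e' : List (Edge m)}
      (ht : t.Perm t') (he : e.Perm e') : Move ⟨arc, t, e⟩ ⟨arc, t', e'⟩
  | rotate (arc : Fin n → List (Item m)) (a b c : ℕ) (t : List (ℕ × ℕ × ℕ)) (e : List (Edge m)) :
      Move ⟨arc, (a, b, c) :: t, e⟩ ⟨arc, (b, c, a) :: t, e⟩
  | flip (arc : Fin n → List (Item m)) (t : List (ℕ × ℕ × ℕ)) (a b : ℕ) (w : List (Letter m))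
      (e : List (Edge m)) :
      Move ⟨arc, t, (a, w, b) :: e⟩ ⟨arc, t, (b, FreeGroup.invRev w, a) :: e⟩
  | arcWord (arc : Fin n → List (Item m)) (j : Fin n) (u v : List (Item m))
      (w w' : List (Letter m)) (hw : FreeGroup.mk w = FreeGroup.mk w')
      (t : List (ℕ × ℕ × ℕ)) (e : List (Edge m)) :
      Move ⟨Function.update arc j (u ++ w.map Item.pass ++ v), t, e⟩
        ⟨Function.update arc j (u ++ w'.map Item.pass ++ v), t, e⟩
  | edgeWord (arc : Fin n → List (Item m)) (t : List (ℕ × ℕ × ℕ)) (a b : ℕ)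
      (w w' : List (Letter m)) (hw : FreeGroup.mk w = FreeGroup.mk w') (e : List (Edge m)) :
      Move ⟨arc, t, (a, w, b) :: e⟩ ⟨arc, t, (a, w', b) :: e⟩
  | dragLeg (arc : Fin n → List (Item m)) (j : Fin n) (u v : List (Item m)) (h : ℕ) (x : Letter m)
      (t : List (ℕ × ℕ × ℕ)) (e : List (Edge m)) :
      Move ⟨Function.update arc j (u ++ [Item.leg h, Item.pass x] ++ v), t, e⟩
        ⟨Function.update arc j (u ++ [Item.pass x, Item.leg h] ++ v), t, e.map (dragEdge x {h})⟩
  | dragTri (arc : Fin n → List (Item m)) (a b c : ℕ) (x : Letter m)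
      (t : List (ℕ × ℕ × ℕ)) (e : List (Edge m)) :
      Move ⟨arc, (a, b, c) :: t, e⟩ ⟨arc, (a, b, c) :: t, e.map (dragEdge x {a, b, c})⟩

/-- The local situation of the STU relation `S = T - U`. In `S` an edge joins the univalent vertex
`h` to a trivalent vertex with half-edges `k, a, b` in cyclic order. In `T` and `U` the half-edges
`a` and `b` end on the arc instead of `h`, in this order along the arc in `T`, and in the opposite
order in `U`. -/
inductive STU : RawDiagram m n → RawDiagram m n → RawDiagram m n → Prop
  | intro (arc : Fin n → List (Item m)) (j : Fin n) (u v : List (Item m)) (h k a b : ℕ)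
      (t : List (ℕ × ℕ × ℕ)) (e : List (Edge m)) :
      STU ⟨Function.update arc j (u ++ [Item.leg h] ++ v), (k, a, b) :: t, (h, [], k) :: e⟩
        ⟨Function.update arc j (u ++ [Item.leg a, Item.leg b] ++ v), t, e⟩
        ⟨Function.update arc j (u ++ [Item.leg b, Item.leg a] ++ v), t, e⟩

/-! ### Stacking with cabling -/

/-- An occurrence of a letter in a diagram: the arc or the number of the edge, the position there,
and the letter. -/
abbrev Passage (n p : ℕ) := (Fin p ⊕ ℕ) × ℕ × Letter n

/-- The passages through handles along the arcs. -/
def arcPassages (D : RawDiagram n p) : List (Passage n p) :=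
  (List.finRange p).flatMap fun j => (D.arc j).zipIdx.filterMap fun y =>
    match y.1 with
    | Item.leg _ => none
    | Item.pass x => some (Sum.inl j, y.2, x)

/-- The passages through handles along the edges. -/
def edgePassages (D : RawDiagram n p) : List (Passage n p) :=
  D.edge.zipIdx.flatMap fun y => y.1.2.1.zipIdx.map fun z => (Sum.inr y.2, z.2, z.1)

/-- All passages of a diagram through handles. -/
def passages (D : RawDiagram n p) : List (Passage n p) := D.arcPassages ++ D.edgePassages

/-- The parallel copy of an arc of `D` that is put in place of the passage `o`. It keeps those
univalent vertices that `f` places on this copy. It is traversed backwards if the letter of `o` is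
an inverse. -/
def strand (D : RawDiagram m n) (f : ℕ → Option (Passage n p)) (o : Passage n p) : List (Item m) :=
  let L : List (Item m) := (D.arc o.2.2.1).filterMap fun
    | Item.leg h => if f h = some o then some (Item.leg (4 * h + 1)) else none
    | Item.pass x => some (Item.pass x)
  if o.2.2.2 then L else (L.map fun
    | Item.leg h => Item.leg h
    | Item.pass x => Item.pass (x.1, !x.2)).reverse

/-- An edge from `a` to `b` along which a sequence of items is met: every univalent vertex `h` of the
sequence becomes a trivalent vertex with half-edges `h + 1` (incoming), `h`, `h + 2` (outgoing), and
the edge is cut there. The word already read is `w`. -/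
def splitEdge (a : ℕ) (w : List (Letter m)) (L : List (Item m)) (b : ℕ) : List (Edge m) :=
  match L with
  | [] => [(a, w, b)]
  | Item.pass x :: L => splitEdge a (w ++ [x]) L b
  | Item.leg h :: L => (a, w, h + 1) :: splitEdge (h + 2) [] L b

/-- The trivalent vertices that `splitEdge` creates, in the cyclic order incoming, `h`, outgoing. -/
def splitTri (L : List (Item m)) : List (ℕ × ℕ × ℕ) := (legNames L).map fun h => (h + 1, h, h + 2)

/-- The items met along the edge number `q` with word `w` after cabling. -/
def edgeItems (D : RawDiagram m n) (f : ℕ → Option (Passage n p)) (q : ℕ) (w : List (Letter n)) :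
    List (Item m) :=
  w.zipIdx.flatMap fun z => D.strand f (Sum.inr q, z.2, z.1)

/-- The diagram obtained from stacking the cabling of `D` on `D'`, with the univalent vertices of `D`
placed on the parallel copies according to `f`. Half-edges `h` of `D'` become `4 * h`, and those of
`D` become `4 * h + 1`. -/
def glue (D' : RawDiagram n p) (D : RawDiagram m n) (f : ℕ → Option (Passage n p)) :
    RawDiagram m p where
  arc j := (D'.arc j).zipIdx.flatMap fun y =>
    match y.1 with
    | Item.leg h => [Item.leg (4 * h)]
    | Item.pass x => D.strand f (Sum.inl j, y.2, x)
  tri := D'.tri.map (renameTri fun h => 4 * h) ++ D.tri.map (renameTri fun h => 4 * h + 1) ++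
    D'.edge.zipIdx.flatMap fun y => splitTri (D.edgeItems f y.2 y.1.2.1)
  edge := D'.edge.zipIdx.flatMap (fun y =>
      splitEdge (4 * y.1.1) [] (D.edgeItems f y.2 y.1.2.1) (4 * y.1.2.2)) ++
    D.edge.map (renameEdge fun h => 4 * h + 1)

/-- A placement: every univalent vertex of `D`, lying on the `i`-th arc say, is put on one of the
parallel copies of this arc, that is, on one of the passages of `D'` through the `i`-th handle. -/
def Placement (D' : RawDiagram n p) (D : RawDiagram m n) : Type :=
  {s : {h // h ∈ D.legs.toFinset} → {o // o ∈ D'.passages.toFinset} //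
    ∀ h, h.1 ∈ legNames (D.arc (s h).1.2.2.1)}

noncomputable instance instFintypePlacement (D' : RawDiagram n p) (D : RawDiagram m n) : Fintype (Placement D' D) :=
  open Classical in inferInstanceAs (Fintype (Subtype _))

/-- A placement as a partial function on names. -/
def Placement.toFun {D' : RawDiagram n p} {D : RawDiagram m n} (s : Placement D' D) (h : ℕ) :
    Option (Passage n p) :=
  if hh : h ∈ D.legs.toFinset then some (s.1 ⟨h, hh⟩).1 else none

/-- The sign of a placement: a factor `-1` for each univalent vertex that is put on a copy which is
traversed backwards. -/
def Placement.sign {D' : RawDiagram n p} {D : RawDiagram m n} (s : Placement D' D) : ℤ :=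
  ∏ h, if (s.1 h).1.2.2.2 then 1 else -1

/-! ### Stacking yields Jacobi diagrams -/

theorem legNames_append (L L' : List (Item m)) :
    legNames (L ++ L') = legNames L ++ legNames L' := by
  simp [legNames]

theorem legNames_flatMap {α : Type*} (l : List α) (g : α → List (Item m)) :
    legNames (l.flatMap g) = l.flatMap fun a => legNames (g a) := by
  induction l with
  | nil => rfl
  | cons a l ih => simp [List.flatMap_cons, legNames_append, ih]

theorem coe_flatMap_sum {α β : Type*} (l : List α) (g : α → List β) :
    ((l.flatMap g : List β) : Multiset β) = (l.map fun a => (g a : Multiset β)).sum := by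
  induction l with
  | nil => rfl
  | cons a l ih => simp [List.flatMap_cons, ← ih]

theorem sum_flatMap {α β M : Type*} [AddCommMonoid M] (l : List α) (g : α → List β) (φ : β → M) :
    ((l.flatMap g).map φ).sum = (l.map fun a => ((g a).map φ).sum).sum := by
  induction l with
  | nil => rfl
  | cons a l ih => simp [List.flatMap_cons, ih]

theorem legNames_strand (D : RawDiagram m n) (f : ℕ → Option (Passage n p)) (o : Passage n p) :
    ((legNames (D.strand f o) : List ℕ) : Multiset ℕ) =
      ((legNames (D.arc o.2.2.1)).filter fun h => f h = some o).map fun h => 4 * h + 1 := by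
  unfold strand
  generalize D.arc o.2.2.1 = L
  have key : ∀ L : List (Item m), legNames (L.filterMap fun
        | Item.leg h => if f h = some o then some (Item.leg (4 * h + 1)) else none
        | Item.pass x => some (Item.pass x)) =
      ((legNames L).filter fun h => f h = some o).map fun h => 4 * h + 1 := by
    intro L
    induction L with
    | nil => rfl
    | cons a L ih =>
      cases a with
      | leg h => by_cases hh : f h = some o <;> simp_all [legNames]
      | pass x => simp_all [legNames]
  have key2 : ∀ L : List (Item m), legNames (L.map fun
        | Item.leg h => Item.leg h
        | Item.pass x => Item.pass (x.1, !x.2)).reverse = (legNames L).reverse := by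
    intro L
    induction L with
    | nil => rfl
    | cons a L ih =>
      cases a <;> simp_all [legNames]
  by_cases ho : o.2.2.2 = true
  · simp only [ho, if_true]
    rw [key L]
  · simp only [ho, Bool.false_eq_true, if_false]
    rw [key2, key L, Multiset.coe_reverse]

/-- The univalent vertices that end up on the strand at `o`, with their new names. -/
def strandLegs (D : RawDiagram m n) (f : ℕ → Option (Passage n p)) (o : Passage n p) :
    Multiset ℕ :=
  ((legNames (D.arc o.2.2.1)).filter fun h => f h = some o).map fun h => 4 * h + 1

/-- The univalent vertices of `D` that are put on edges, with their new names. -/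
def dashed (D' : RawDiagram n p) (D : RawDiagram m n) (f : ℕ → Option (Passage n p)) :
    Multiset ℕ :=
  (D'.edgePassages.map (D.strandLegs f)).sum

theorem legs_glue (D' : RawDiagram n p) (D : RawDiagram m n) (f : ℕ → Option (Passage n p)) :
    (glue D' D f).legs =
      D'.legs.map (fun h => 4 * h) + (D'.arcPassages.map (D.strandLegs f)).sum := by
  have key : ∀ (j : Fin p) (l : List (Item n × ℕ)),
      ((legNames (l.flatMap fun y =>
        match y.1 with
        | Item.leg h => [Item.leg (4 * h)]
        | Item.pass x => D.strand f (Sum.inl j, y.2, x)) : List ℕ) : Multiset ℕ) =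
      ((legNames (l.map Prod.fst) : List ℕ) : Multiset ℕ).map (fun h => 4 * h) +
      ((l.filterMap fun y =>
        match y.1 with
        | Item.leg _ => none
        | Item.pass x => some ((Sum.inl j, y.2, x) : Passage n p)).map (D.strandLegs f)).sum := by
    intro j l
    induction l with
    | nil => rfl
    | cons a l ih =>
      obtain ⟨a, k⟩ := a
      rw [List.flatMap_cons, legNames_append, ← Multiset.coe_add, ih]
      cases a with
      | leg h =>
        simp [legNames, ← Multiset.cons_coe, Multiset.map_cons]
      | pass x =>
        simp only [legNames_strand, List.map_cons]
        simp only [legNames, List.filterMap_cons, List.map_cons, List.sum_cons, strandLegs]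
        abel
  unfold legs arcPassages
  rw [sum_flatMap]
  have : ∀ j, ((legNames ((glue D' D f).arc j) : List ℕ) : Multiset ℕ) = _ :=
    fun j => key j (D'.arc j).zipIdx
  simp only [this, List.zipIdx_map_fst]
  rw [Finset.sum_add_distrib, ← Multiset.coe_mapAddMonoidHom, map_sum, Fin.sum_univ_def,
    Fin.sum_univ_def]

theorem sum_triNames_rename (f : ℕ → ℕ) (t : List (ℕ × ℕ × ℕ)) :
    ((t.map (renameTri f)).map triNames).sum = ((t.map triNames).sum).map f := by
  induction t with
  | nil => rfl
  | cons a t ih =>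
    rw [List.map_cons, List.map_cons, List.sum_cons, ih, List.map_cons, List.sum_cons,
      Multiset.map_add]
    simp [triNames, renameTri]

theorem sum_edgeNames_rename (f : ℕ → ℕ) (t : List (Edge m)) :
    ((t.map (renameEdge f)).map edgeNames).sum = ((t.map edgeNames).sum).map f := by
  induction t with
  | nil => rfl
  | cons a t ih =>
    rw [List.map_cons, List.map_cons, List.sum_cons, ih, List.map_cons, List.sum_cons,
      Multiset.map_add]
    simp [edgeNames, renameEdge]

theorem sum_splitTri (L : List (Item m)) :
    ((splitTri L).map triNames).sum = (legNames L : Multiset ℕ) +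
      ((legNames L : Multiset ℕ).bind fun h => {h + 1, h + 2}) := by
  unfold splitTri
  induction legNames L with
  | nil => rfl
  | cons a t ih =>
    rw [← Multiset.cons_coe, Multiset.cons_bind]
    simp only [List.map_cons, List.sum_cons, ih, triNames,
      Multiset.insert_eq_cons, ← Multiset.singleton_add]
    abel

theorem sum_splitEdge (L : List (Item m)) (a b : ℕ) (w : List (Letter m)) :
    ((splitEdge a w L b).map edgeNames).sum = {a, b} +
      ((legNames L : Multiset ℕ).bind fun h => {h + 1, h + 2}) := by
  induction L generalizing a w with
  | nil => simp [splitEdge, edgeNames, legNames]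
  | cons i L ih =>
    cases i with
    | leg h =>
      have : legNames (Item.leg h :: L) = h :: legNames L := rfl
      rw [this, ← Multiset.cons_coe, Multiset.cons_bind]
      simp only [splitEdge, List.map_cons, List.sum_cons, ih,
        edgeNames, Multiset.insert_eq_cons, ← Multiset.singleton_add]
      abel
    | pass x =>
      have : legNames (Item.pass x :: L) = legNames L := rfl
      simp only [splitEdge, ih, this]

theorem legNames_edgeItems (D : RawDiagram m n) (f : ℕ → Option (Passage n p)) (q : ℕ)
    (w : List (Letter n)) :
    ((legNames (D.edgeItems f q w) : List ℕ) : Multiset ℕ) =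
      ((w.zipIdx.map fun z => ((Sum.inr q, z.2, z.1) : Passage n p)).map (D.strandLegs f)).sum := by
  unfold edgeItems
  rw [legNames_flatMap, coe_flatMap_sum, List.map_map]
  congr 1
  apply List.map_congr_left
  intro z _
  exact legNames_strand D f _

theorem dashed_eq (D' : RawDiagram n p) (D : RawDiagram m n) (f : ℕ → Option (Passage n p)) :
    dashed D' D f = (D'.edge.zipIdx.map fun y =>
      ((legNames (D.edgeItems f y.2 y.1.2.1) : List ℕ) : Multiset ℕ)).sum := by
  unfold dashed edgePassages
  rw [sum_flatMap]
  congr 1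
  apply List.map_congr_left
  intro z _
  exact (legNames_edgeItems D f _ _).symm

theorem bind_list_sum {α β : Type*} (l : List (Multiset α)) (g : α → Multiset β) :
    l.sum.bind g = (l.map fun s => s.bind g).sum := by
  induction l with
  | nil => rfl
  | cons a l ih => simp [Multiset.add_bind, ih]

theorem triHalf_glue (D' : RawDiagram n p) (D : RawDiagram m n) (f : ℕ → Option (Passage n p)) :
    (glue D' D f).triHalf = D'.triHalf.map (fun h => 4 * h) + D.triHalf.map (fun h => 4 * h + 1) +
      (dashed D' D f + (dashed D' D f).bind fun h => {h + 1, h + 2}) := by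
  unfold triHalf glue
  simp only [List.map_append, List.sum_append, sum_triNames_rename, sum_flatMap, sum_splitTri]
  rw [dashed_eq, bind_list_sum, List.map_map]
  congr 1
  exact List.sum_map_add

theorem edgeHalf_glue (D' : RawDiagram n p) (D : RawDiagram m n) (f : ℕ → Option (Passage n p)) :
    (glue D' D f).edgeHalf = D'.edgeHalf.map (fun h => 4 * h) +
      ((dashed D' D f).bind fun h => {h + 1, h + 2}) + D.edgeHalf.map (fun h => 4 * h + 1) := by
  unfold edgeHalf glue
  simp only [List.map_append, List.sum_append, sum_edgeNames_rename, sum_flatMap, sum_splitEdge]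
  rw [dashed_eq, bind_list_sum, List.map_map, List.sum_map_add]
  congr 2
  rw [← sum_edgeNames_rename]
  have : D'.edge = D'.edge.zipIdx.map Prod.fst := (List.zipIdx_map_fst 0 _).symm
  conv_rhs => rw [this]
  simp only [List.map_map]
  rfl

theorem nodup_passages (D : RawDiagram n p) : D.passages.Nodup := by
  unfold passages
  rw [List.nodup_append]
  refine ⟨?_, ?_, ?_⟩
  · unfold arcPassages
    rw [List.nodup_flatMap]
    refine ⟨fun j _ => ?_, ?_⟩
    · have h : ((D.arc j).zipIdx.map Prod.snd).Nodup := by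
        rw [List.zipIdx_map_snd]; exact List.nodup_range'
      refine List.Nodup.filterMap ?_ h.of_map
      rintro ⟨a, k⟩ ⟨b, l⟩ o ha hb
      cases a <;> cases b <;> simp_all
      subst ha
      simp_all
    · refine (List.nodup_finRange p).imp ?_
      intro j k hjk o ho ho'
      simp only [List.mem_filterMap] at ho ho'
      obtain ⟨⟨a, r⟩, _, ha⟩ := ho
      obtain ⟨⟨b, s⟩, _, hb⟩ := ho'
      cases a <;> cases b <;> simp_all
      subst ha
      simp_all
  · unfold edgePassages
    rw [List.nodup_flatMap]
    refine ⟨fun y _ => ?_, ?_⟩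
    · have h : (y.1.2.1.zipIdx.map Prod.snd).Nodup := by
        rw [List.zipIdx_map_snd]; exact List.nodup_range'
      refine List.Nodup.map ?_ h.of_map
      rintro ⟨a, k⟩ ⟨b, l⟩ hab
      simp_all
    · have h : (D.edge.zipIdx.map Prod.snd).Nodup := by
        rw [List.zipIdx_map_snd]; exact List.nodup_range'
      rw [List.Nodup, List.pairwise_map] at h
      refine h.imp ?_
      intro y z hyz o ho ho'
      simp only [List.mem_map] at ho ho'
      obtain ⟨a, _, ha⟩ := ho
      obtain ⟨b, _, hb⟩ := ho'
      subst ha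
      simp_all
  · intro o ho o' ho' h
    subst h
    simp only [arcPassages, edgePassages, List.mem_flatMap, List.mem_filterMap, List.mem_map] at ho ho'
    obtain ⟨_, _, ⟨a, r⟩, _, ha⟩ := ho
    obtain ⟨_, _, _, _, hb⟩ := ho'
    subst hb
    cases a <;> simp_all

theorem Placement.toFun_spec {D' : RawDiagram n p} {D : RawDiagram m n} (s : Placement D' D) {h : ℕ}
    (hh : h ∈ D.legs) :
    ∃ o ∈ D'.passages, s.toFun h = some o ∧ h ∈ legNames (D.arc o.2.2.1) := by
  have hm := Multiset.mem_toFinset.2 hh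
  refine ⟨(s.1 ⟨h, hm⟩).1, List.mem_toFinset.1 (s.1 ⟨h, hm⟩).2, ?_, s.2 ⟨h, hm⟩⟩
  rw [Placement.toFun, dif_pos hm]

theorem mem_legs {D : RawDiagram m n} {h : ℕ} : h ∈ D.legs ↔ ∃ j, h ∈ legNames (D.arc j) := by
  simp [legs, Multiset.mem_sum]

theorem sum_strandLegs {D' : RawDiagram n p} {D : RawDiagram m n} (hD : D.legs.Nodup)
    (s : Placement D' D) :
    (D'.passages.map (D.strandLegs s.toFun)).sum = D.legs.map fun h => 4 * h + 1 := by
  have h1 : (D'.passages.map (D.strandLegs s.toFun)).sum =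
      ((D'.passages.map fun o => ((((legNames (D.arc o.2.2.1)).filter
        fun h => s.toFun h = some o) : List ℕ) : Multiset ℕ)).sum).map fun h => 4 * h + 1 := by
    induction D'.passages with
    | nil => rfl
    | cons a l ih =>
      simp only [List.map_cons, List.sum_cons, ih, Multiset.map_add]
      rfl
  rw [h1]
  congr 1
  have hnd : ∀ j, (legNames (D.arc j)).Nodup := by
    intro j
    rw [← Multiset.coe_nodup]
    refine Multiset.nodup_of_le ?_ hD
    exact Finset.single_le_sum (f := fun j => (legNames (D.arc j) : Multiset ℕ))
      (fun _ _ => Multiset.zero_le _) (Finset.mem_univ j)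
  rw [← coe_flatMap_sum]
  refine (Multiset.Nodup.ext ?_ hD).2 ?_
  · rw [Multiset.coe_nodup, List.nodup_flatMap]
    refine ⟨fun o _ => (hnd _).filter _, ?_⟩
    refine (nodup_passages D').imp ?_
    intro o o' hoo h ho ho'
    simp only [List.mem_filter, decide_eq_true_eq] at ho ho'
    exact hoo (Option.some_injective _ (ho.2.symm.trans ho'.2))
  · intro h
    simp only [Multiset.mem_coe, List.mem_flatMap, List.mem_filter, decide_eq_true_eq]
    constructor
    · rintro ⟨o, _, ho, _⟩
      exact mem_legs.2 ⟨_, ho⟩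
    · intro hh
      obtain ⟨o, ho, h2, h3⟩ := s.toFun_spec hh
      exact ⟨o, ho, h3, h2⟩

theorem linked_symm (D : RawDiagram m n) {h k : ℕ} (hl : D.Linked h k) : D.Linked k h := by
  rcases hl with (⟨e, he, h1, h2⟩ | ⟨t, ht, h1, h2⟩)
  · exact Or.inl ⟨e, he, h2, h1⟩
  · exact Or.inr ⟨t, ht, h2, h1⟩

theorem splitEdge_connected (G : RawDiagram m p) (L : List (Item m)) (a b : ℕ) (w : List (Letter m))
    (he : ∀ e ∈ splitEdge a w L b, e ∈ G.edge) (ht : ∀ t ∈ splitTri L, t ∈ G.tri) :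
    ReflTransGen G.Linked b a ∧ ∀ h ∈ legNames L, ReflTransGen G.Linked h a ∧
      ReflTransGen G.Linked (h + 1) a ∧ ReflTransGen G.Linked (h + 2) a := by
  induction L generalizing a w with
  | nil =>
    refine ⟨.single (Or.inl ⟨(a, w, b), he _ (by simp [splitEdge]), ?_, ?_⟩), by simp [legNames]⟩ <;>
      simp [edgeNames]
  | cons i L ih =>
    cases i with
    | pass x => exact ih a (w ++ [x]) he ht
    | leg h =>
      have hn : legNames (Item.leg h :: L) = h :: legNames L := rfl
      have htri : (h + 1, h, h + 2) ∈ G.tri := ht _ (by simp [splitTri, hn])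
      have hedge : (a, w, h + 1) ∈ G.edge := he _ (by simp [splitEdge])
      have c1 : ReflTransGen G.Linked (h + 1) a :=
        .single (Or.inl ⟨_, hedge, by simp [edgeNames], by simp [edgeNames]⟩)
      have c0 : ReflTransGen G.Linked h a :=
        .head (Or.inr ⟨_, htri, by simp [triNames], by simp [triNames]⟩) c1
      have c2 : ReflTransGen G.Linked (h + 2) a :=
        .head (Or.inr ⟨_, htri, by simp [triNames], by simp [triNames]⟩) c1
      obtain ⟨hb, hL⟩ := ih (h + 2) [] (fun e h' => he e (by simp [splitEdge, h']))
        (fun t h' => ht t (by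
          simp only [splitTri, hn, List.map_cons, List.mem_cons]; exact Or.inr h'))
      refine ⟨hb.trans c2, ?_⟩
      intro k hk
      rw [hn, List.mem_cons] at hk
      rcases hk with rfl | hk
      · exact ⟨c0, c1, c2⟩
      · exact ⟨(hL k hk).1.trans c2, (hL k hk).2.1.trans c2, (hL k hk).2.2.trans c2⟩

theorem mem_edgeHalf {D : RawDiagram m n} {h : ℕ} :
    h ∈ D.edgeHalf ↔ ∃ e ∈ D.edge, h ∈ edgeNames e := by
  unfold edgeHalf
  induction D.edge with
  | nil => simp
  | cons a l ih => simp [ih]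

theorem isJacobi_glue {D' : RawDiagram n p} {D : RawDiagram m n} (hD' : D'.IsJacobi)
    (hD : D.IsJacobi) (s : Placement D' D) : (glue D' D s.toFun).IsJacobi := by
  have hsum : (D'.arcPassages.map (D.strandLegs s.toFun)).sum + dashed D' D s.toFun =
      D.legs.map fun h => 4 * h + 1 := by
    rw [← sum_strandLegs (Multiset.nodup_add.1 hD.nodup).1 s, passages, List.map_append,
      List.sum_append, dashed]
  have hatt : (glue D' D s.toFun).legs + (glue D' D s.toFun).triHalf =
      (D'.legs + D'.triHalf).map (fun h => 4 * h) + (D.legs + D.triHalf).map (fun h => 4 * h + 1) +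
        (dashed D' D s.toFun).bind fun h => {h + 1, h + 2} := by
    rw [legs_glue, triHalf_glue, Multiset.map_add, Multiset.map_add, ← hsum]
    abel
  have hmatch : (glue D' D s.toFun).edgeHalf =
      (glue D' D s.toFun).legs + (glue D' D s.toFun).triHalf := by
    rw [hatt, edgeHalf_glue, hD'.matched, hD.matched]
    abel
  have hle : dashed D' D s.toFun ≤ D.legs.map fun h => 4 * h + 1 := by
    rw [← hsum]; exact Multiset.le_add_left _ _
  have hmod : ∀ h ∈ dashed D' D s.toFun, h % 4 = 1 := by
    intro h hh
    obtain ⟨k, _, rfl⟩ := Multiset.mem_map.1 (Multiset.mem_of_le hle hh)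
    omega
  refine ⟨?_, hmatch, ?_⟩
  · rw [hatt, Multiset.nodup_add, Multiset.nodup_add]
    refine ⟨⟨hD'.nodup.map fun a b h => ?_, hD.nodup.map fun a b h => ?_, ?_⟩, ?_, ?_⟩
    · simpa using h
    · simpa using h
    · rw [Multiset.disjoint_left]
      intro a ha hb
      obtain ⟨k, _, rfl⟩ := Multiset.mem_map.1 ha
      obtain ⟨l, _, hl⟩ := Multiset.mem_map.1 hb
      omega
    · have hnd : (dashed D' D s.toFun).Nodup :=
        Multiset.nodup_of_le hle ((Multiset.nodup_add.1 hD.nodup).1.map fun a b h => by simpa using h)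
      rw [Multiset.nodup_bind]
      refine ⟨fun a _ => by simp, ?_⟩
      refine hnd.pairwise ?_
      intro a ha b hb hab
      have := hmod a ha
      have := hmod b hb
      rw [Function.onFun, Multiset.disjoint_left]
      intro x hx hy
      simp only [Multiset.insert_eq_cons, Multiset.mem_cons, Multiset.mem_singleton] at hx hy
      omega
    · rw [Multiset.disjoint_left]
      intro a ha hb
      obtain ⟨k, hk, hka⟩ := Multiset.mem_bind.1 hb
      have := hmod k hk
      simp only [Multiset.insert_eq_cons, Multiset.mem_cons, Multiset.mem_singleton] at hka
      rcases Multiset.mem_add.1 ha with h | h <;>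
      · obtain ⟨l, _, hl⟩ := Multiset.mem_map.1 h
        omega
  · set G := glue D' D s.toFun with hG
    have hsymm : ∀ h k, ReflTransGen G.Linked h k → ReflTransGen G.Linked k h := by
      intro h k hhk
      induction hhk with
      | refl => exact .refl
      | tail _ hl ih => exact .head (G.linked_symm hl) ih
    have split : ∀ y ∈ D'.edge.zipIdx, _ := fun y hy =>
      splitEdge_connected G (D.edgeItems s.toFun y.2 y.1.2.1) (4 * y.1.1) (4 * y.1.2.2) []
        (fun e he => List.mem_append_left _ (List.mem_flatMap.2 ⟨y, hy, he⟩))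
        (fun t ht => List.mem_append_right _ (List.mem_flatMap.2 ⟨y, hy, ht⟩))
    -- half-edges that stem from the upper diagram
    have h4 : ∀ h k, ReflTransGen D'.Linked h k → ReflTransGen G.Linked (4 * h) (4 * k) := by
      intro h k hhk
      induction hhk with
      | refl => exact .refl
      | tail _ hl ih =>
        refine ih.trans ?_
        rcases hl with ⟨e, he, h1, h2⟩ | ⟨t, ht, h1, h2⟩
        · obtain ⟨i, hi⟩ := List.getElem_of_mem he
          have hy : (e, i) ∈ D'.edge.zipIdx := by
            rw [List.mem_zipIdx_iff_getElem?]
            obtain ⟨hlt, heq⟩ := hi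
            simp [hlt, heq]
          have hc := (split _ hy).1
          have hc' := hsymm _ _ hc
          simp only [edgeNames, Multiset.insert_eq_cons, Multiset.mem_cons,
            Multiset.mem_singleton] at h1 h2
          rcases h1 with rfl | rfl <;> rcases h2 with rfl | rfl <;>
            first | exact .refl | exact hc | exact hc'
        · refine .single (Or.inr ⟨renameTri (fun h => 4 * h) t, ?_, ?_, ?_⟩)
          · exact List.mem_append_left _ (List.mem_append_left _ (List.mem_map_of_mem ht))
          · simp only [triNames, Multiset.insert_eq_cons, Multiset.mem_cons,
              Multiset.mem_singleton, renameTri] at h1 ⊢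
            omega
          · simp only [triNames, Multiset.insert_eq_cons, Multiset.mem_cons,
              Multiset.mem_singleton, renameTri] at h2 ⊢
            omega
    have h41 : ∀ h k, ReflTransGen D.Linked h k →
        ReflTransGen G.Linked (4 * h + 1) (4 * k + 1) := by
      intro h k hhk
      induction hhk with
      | refl => exact .refl
      | tail _ hl ih =>
        refine ih.tail ?_
        rcases hl with ⟨e, he, h1, h2⟩ | ⟨t, ht, h1, h2⟩
        · refine Or.inl ⟨renameEdge (fun h => 4 * h + 1) e, ?_, ?_, ?_⟩
          · exact List.mem_append_right _ (List.mem_map_of_mem he)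
          · simp only [edgeNames, Multiset.insert_eq_cons, Multiset.mem_cons,
              Multiset.mem_singleton, renameEdge] at h1 ⊢
            omega
          · simp only [edgeNames, Multiset.insert_eq_cons, Multiset.mem_cons,
              Multiset.mem_singleton, renameEdge] at h2 ⊢
            omega
        · refine Or.inr ⟨renameTri (fun h => 4 * h + 1) t, ?_, ?_, ?_⟩
          · exact List.mem_append_left _ (List.mem_append_right _ (List.mem_map_of_mem ht))
          · simp only [triNames, Multiset.insert_eq_cons, Multiset.mem_cons,
              Multiset.mem_singleton, renameTri] at h1 ⊢
            omega
          · simp only [triNames, Multiset.insert_eq_cons, Multiset.mem_cons,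
              Multiset.mem_singleton, renameTri] at h2 ⊢
            omega
    have anch4 : ∀ h ∈ D'.edgeHalf, ∃ l ∈ G.legs, ReflTransGen G.Linked (4 * h) l := by
      intro h hh
      obtain ⟨l, hl, hc⟩ := hD'.anchored h hh
      refine ⟨4 * l, ?_, h4 _ _ hc⟩
      rw [hG, legs_glue]
      exact Multiset.mem_add.2 (Or.inl (Multiset.mem_map_of_mem _ hl))
    have memZip : ∀ y ∈ D'.edge.zipIdx, y.1.1 ∈ D'.edgeHalf := fun y hy =>
      mem_edgeHalf.2 ⟨y.1, List.fst_mem_of_mem_zipIdx hy, by simp [edgeNames]⟩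
    have anchDash : ∀ l ∈ dashed D' D s.toFun, ∃ y ∈ D'.edge.zipIdx,
        l ∈ legNames (D.edgeItems s.toFun y.2 y.1.2.1) := by
      intro l hl
      rw [dashed_eq, ← coe_flatMap_sum] at hl
      simpa using hl
    have anch1 : ∀ h ∈ D.edgeHalf, ∃ l ∈ G.legs, ReflTransGen G.Linked (4 * h + 1) l := by
      intro h hh
      obtain ⟨l, hl, hc⟩ := hD.anchored h hh
      have hm : 4 * l + 1 ∈ (D'.arcPassages.map (D.strandLegs s.toFun)).sum + dashed D' D s.toFun := by
        rw [hsum]; exact Multiset.mem_map_of_mem _ hl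
      rcases Multiset.mem_add.1 hm with hm | hm
      · refine ⟨4 * l + 1, ?_, h41 _ _ hc⟩
        rw [hG, legs_glue]
        exact Multiset.mem_add.2 (Or.inr hm)
      · obtain ⟨y, hy, hly⟩ := anchDash _ hm
        obtain ⟨r, hr, hcr⟩ := anch4 _ (memZip y hy)
        exact ⟨r, hr, (h41 _ _ hc).trans ((((split y hy).2 _ hly).1).trans hcr)⟩
    intro h hh
    rw [hG, edgeHalf_glue] at hh
    rcases Multiset.mem_add.1 hh with hh | hh
    · rcases Multiset.mem_add.1 hh with hh | hh
      · obtain ⟨k, hk, rfl⟩ := Multiset.mem_map.1 hh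
        exact anch4 k hk
      · obtain ⟨k, hk, hkh⟩ := Multiset.mem_bind.1 hh
        obtain ⟨y, hy, hly⟩ := anchDash _ hk
        obtain ⟨r, hr, hcr⟩ := anch4 _ (memZip y hy)
        have hc := (split y hy).2 _ hly
        simp only [Multiset.insert_eq_cons, Multiset.mem_cons, Multiset.mem_singleton] at hkh
        rcases hkh with rfl | rfl
        · exact ⟨r, hr, hc.2.1.trans hcr⟩
        · exact ⟨r, hr, hc.2.2.trans hcr⟩
    · obtain ⟨k, hk, rfl⟩ := Multiset.mem_map.1 hh
      exact anch1 k hk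

end RawDiagram

/-! ### The hom-spaces, their degree filtration and the composition -/

/-- `(m, n)`-Jacobi diagrams in handlebodies. -/
def JacobiDiagram (m n : ℕ) : Type := {D : RawDiagram m n // D.IsJacobi}

/-- The degree: half the number of vertices (this number is even). -/
def JacobiDiagram.degree {m n : ℕ} (D : JacobiDiagram m n) : ℕ :=
  (D.1.legs.card + D.1.tri.length) / 2

section

variable (K : Type*) [Field K]

/-- Formal linear combinations of `(m, n)`-Jacobi diagrams. -/
abbrev Chains (m n : ℕ) := JacobiDiagram m n →₀ K

/-- The subspace spanned by the identifications of diagrams and by the STU relation. -/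
noncomputable def relations (m n : ℕ) : Submodule K (Chains K m n) :=
  Submodule.span K
    ({c | ∃ D D' : JacobiDiagram m n, RawDiagram.Move D.1 D'.1 ∧
        c = Finsupp.single D 1 - Finsupp.single D' 1} ∪
      {c | ∃ S T U : JacobiDiagram m n, RawDiagram.STU S.1 T.1 U.1 ∧
        c = Finsupp.single S 1 - (Finsupp.single T 1 - Finsupp.single U 1)})

/-- The space of morphisms from `m` to `n` in the category of Jacobi diagrams in handlebodies. -/
abbrev Hom (m n : ℕ) := Chains K m n ⧸ relations K m n

/-- The part of degree at least `d` of a space of morphisms. -/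
noncomputable def degreeGE (d m n : ℕ) : Submodule K (Hom K m n) :=
  Submodule.span K
    {x | ∃ D : JacobiDiagram m n, d ≤ D.degree ∧
      x = (relations K m n).mkQ (Finsupp.single D 1)}

variable {K} {m n p : ℕ}

/-- Stacking a suitable cabling of `D` on `D'`: the signed sum over all ways to put the univalent
vertices of `D` on the parallel copies of the arcs of `D`. -/
noncomputable def stackDiagram (D' : JacobiDiagram n p) (D : JacobiDiagram m n) : Chains K m p :=
  ∑ s : RawDiagram.Placement D'.1 D.1, (s.sign : K) •
    Finsupp.single ⟨RawDiagram.glue D'.1 D.1 s.toFun, RawDiagram.isJacobi_glue D'.2 D.2 s⟩ 1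

/-- The bilinear extension of `stackDiagram`. -/
noncomputable def stack (φ : Chains K n p) (ξ : Chains K m n) : Chains K m p :=
  φ.sum fun D' a => ξ.sum fun D b => (a * b) • stackDiagram D' D

/-- `y` is the composition `f ∘ x`: it is represented by the stacking of a representative of `f` and
a representative of `x`. -/
def IsComposition (f : Hom K n p) (x : Hom K m n) (y : Hom K m p) : Prop :=
  ∃ (φ : Chains K n p) (ξ : Chains K m n), (relations K n p).mkQ φ = f ∧
    (relations K m n).mkQ ξ = x ∧ (relations K m p).mkQ (stack φ ξ) = y

variable (K)

/-- The value at `n` of the quotient of the part of degree at least `d` of the module represented by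
`0` by its part of degree at least `d'`. -/
abbrev Subquotient (d d' n : ℕ) :=
  degreeGE K d 0 n ⧸ (degreeGE K d' 0 n).submoduleOf (degreeGE K d 0 n)

variable {K}

/-- A family of subspaces of the quotient is a submodule over the category of Jacobi diagrams if it
is stable under the action of all morphisms, which is given by composition. -/
def IsStable {d d' : ℕ} (W : ∀ n, Submodule K (Subquotient K d d' n)) : Prop :=
  ∀ (m n : ℕ) (f : Hom K m n) (x : degreeGE K d 0 m) (y : degreeGE K d 0 n),
    IsComposition f x.1 y.1 → Submodule.Quotient.mk x ∈ W m → Submodule.Quotient.mk y ∈ W n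

variable (K)

/-- The quotient is an indecomposable module: it is not zero, and it is not the direct sum of two
nonzero submodules. -/
def IsIndecomposable (d d' : ℕ) : Prop :=
  (∃ n, Nontrivial (Subquotient K d d' n)) ∧
    ∀ F G : ∀ n, Submodule K (Subquotient K d d' n), IsStable F → IsStable G →
      (∀ n, IsCompl (F n) (G n)) → (∀ n, F n = ⊥) ∨ ∀ n, G n = ⊥

end

end JacobiHandlebody

namespace JacobiHandlebody

open Relation

namespace RawDiagram

variable {m n p : ℕ}

/-! ### Counting edges -/

/-! The module is generated by one element. Let c be the diagram `chords d`: d chords on 2d arcs,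
with one univalent vertex on each arc. By STU every morphism from 0 is a combination of chord
diagrams, in which only the order of the univalent vertices along the arcs is left
(`degreeGE_le_of_chords`). A chord diagram with at least d chords is f ∘ c, where f keeps all but d
of the chords and has passages through handles in place of the ends of those d
(`exists_act_chords_eq`). Degrees add under composition. So a submodule that contains c up to terms
of degree at least d + 1, and everything of degree at least d', contains everything: the error terms
are pushed up degree by degree (`IsSplitting.le_of_chords_mem`).

Suppose that F and G split the module modulo degree d', and let ξ be the component of c in F. A
morphism that annihilates c modulo degree d' also annihilates ξ, since its value on ξ lies in F and
in G (`IsSplitting.act_mem`). It suffices to find enough such morphisms to force ξ = a c modulo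
degree d + 1. If a is not 0, then F contains c up to higher degree; if a = 0, then G does, because
of c - ξ.

Two kinds of annihilators are enough. First, omitting the i-th arc annihilates c, so ξ can be
represented by diagrams with univalent vertices on all 2d arcs (`IsSplitting.exists_component`). In
degree d these are perfect matchings of the arcs. Second, there are degree 1 morphisms f_0, ..., f_d
with f_j ∘ c = `chords (d + 1)`, where f_j supplies the j-th chord; so f_j - f_d annihilates c for
every j < d. Each diagram of f_j ∘ ξ joins the arcs 2j and 2j + 1, whereas f_d ∘ ξ shows the
matchings of ξ unchanged on the first 2d arcs. Hence a matching that does not join 2j to 2j + 1 has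
coefficient 0 in ξ (`chordForm_eq_zero_of_add_chord`), and only the matching of c is left. The
comparison takes place in degree d + 1, which must survive in the quotient: this is the role of d' ≥
d + 2.

Coefficients are read off with `chordForm`, which counts chord diagrams according to which arcs they
join. -/

theorem card_list_sum {α β : Type*} (l : List β) (g : β → Multiset α) (k : ℕ)
    (hg : ∀ b, (g b).card = k) : (l.map g).sum.card = k * l.length := by
  induction l with
  | nil => simp
  | cons a l ih => simp [ih, hg, Nat.mul_succ, add_comm]

theorem card_triHalf (D : RawDiagram m n) : D.triHalf.card = 3 * D.tri.length :=
  card_list_sum _ _ _ fun t => by simp [triNames]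

theorem card_edgeHalf (D : RawDiagram m n) : D.edgeHalf.card = 2 * D.edge.length :=
  card_list_sum _ _ _ fun t => by simp [edgeNames]

theorem IsJacobi.two_mul_length_edge {D : RawDiagram m n} (hD : D.IsJacobi) :
    2 * D.edge.length = D.legs.card + 3 * D.tri.length := by
  rw [← card_edgeHalf, ← card_triHalf, hD.matched, Multiset.card_add]

/-- A univalent vertex that is put on an edge becomes a trivalent vertex and cuts the edge in two.
So the number of edges minus the number of trivalent vertices is additive. -/
theorem length_edge_glue (D' : RawDiagram n p) (D : RawDiagram m n) (f : ℕ → Option (Passage n p)) :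
    (glue D' D f).edge.length + (D'.tri.length + D.tri.length) =
      (glue D' D f).tri.length + (D'.edge.length + D.edge.length) := by
  have h1 := congrArg Multiset.card (triHalf_glue D' D f)
  have h2 := congrArg Multiset.card (edgeHalf_glue D' D f)
  simp only [Multiset.card_add, Multiset.card_map, card_triHalf, card_edgeHalf,
    Multiset.card_bind, Function.comp_def, Multiset.insert_eq_cons, Multiset.card_cons,
    Multiset.card_singleton, Multiset.map_const', Multiset.sum_replicate, smul_eq_mul] at h1 h2
  omega

end RawDiagram

/-- Counting half-edges gives 2e = l + 3t for e edges, l univalent and t trivalent vertices, so half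
of l + t is e - t. In this form the degree is visibly additive under gluing. -/
theorem JacobiDiagram.degree_add_length_tri {m n : ℕ} (D : JacobiDiagram m n) :
    D.degree + D.1.tri.length = D.1.edge.length := by
  have := D.2.two_mul_length_edge
  unfold JacobiDiagram.degree
  omega

theorem degree_glue {m n p : ℕ} (D' : JacobiDiagram n p) (D : JacobiDiagram m n)
    (s : RawDiagram.Placement D'.1 D.1) :
    JacobiDiagram.degree ⟨RawDiagram.glue D'.1 D.1 s.toFun, RawDiagram.isJacobi_glue D'.2 D.2 s⟩ =
      D'.degree + D.degree := by
  have h1 := JacobiDiagram.degree_add_length_tri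
    ⟨RawDiagram.glue D'.1 D.1 s.toFun, RawDiagram.isJacobi_glue D'.2 D.2 s⟩
  have h2 := D.degree_add_length_tri
  have h3 := D'.degree_add_length_tri
  have h4 := RawDiagram.length_edge_glue D'.1 D.1 s.toFun
  simp only at h1
  omega

/-! ### Classes of diagrams -/

section

variable (K : Type*) [Field K] {m n p : ℕ}

/-- The morphism represented by a diagram. -/
noncomputable def cls (D : JacobiDiagram m n) : Hom K m n :=
  (relations K m n).mkQ (Finsupp.single D 1)

theorem cls_eq_of_move {D D' : JacobiDiagram m n} (h : RawDiagram.Move D.1 D'.1) :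
    cls K D = cls K D' := by
  rw [cls, cls, ← sub_eq_zero, ← map_sub, Submodule.mkQ_apply, Submodule.Quotient.mk_eq_zero]
  exact Submodule.subset_span (Or.inl ⟨D, D', h, rfl⟩)

theorem cls_eq_of_stu {S T U : JacobiDiagram m n} (h : RawDiagram.STU S.1 T.1 U.1) :
    cls K S = cls K T - cls K U := by
  rw [cls, cls, cls, ← sub_eq_zero, ← map_sub, ← map_sub, Submodule.mkQ_apply,
    Submodule.Quotient.mk_eq_zero]
  exact Submodule.subset_span (Or.inr ⟨S, T, U, h, rfl⟩)

/-- Linear combinations of diagrams of degree at least `d`. -/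
noncomputable def chainsGE (d m n : ℕ) : Submodule K (Chains K m n) :=
  Finsupp.supported K K {D | d ≤ D.degree}

/-- Lifts a class to a combination of diagrams of the same degree bound. The morphisms below act on
such representatives, so it does not matter whether stacking respects the relations. -/
theorem degreeGE_eq_map (d m n : ℕ) :
    degreeGE K d m n = (chainsGE K d m n).map (relations K m n).mkQ := by
  rw [chainsGE, Finsupp.supported_eq_span_single, Submodule.map_span, degreeGE]
  congr 1
  ext x
  simp only [Set.mem_ofPred_eq, Set.mem_image, exists_exists_and_eq_and]
  exact ⟨fun ⟨D, h1, h2⟩ => ⟨D, h1, h2.symm⟩, fun ⟨D, h1, h2⟩ => ⟨D, h1, h2.symm⟩⟩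

variable {K}

theorem mkQ_mem_degreeGE {d : ℕ} {ξ : Chains K m n} (h : ξ ∈ chainsGE K d m n) :
    (relations K m n).mkQ ξ ∈ degreeGE K d m n := by
  rw [degreeGE_eq_map]
  exact Submodule.mem_map_of_mem h

theorem exists_chain_of_mem_degreeGE {d : ℕ} {x : Hom K m n} (h : x ∈ degreeGE K d m n) :
    ∃ ξ ∈ chainsGE K d m n, (relations K m n).mkQ ξ = x := by
  rwa [degreeGE_eq_map, Submodule.mem_map] at h

theorem cls_mem_degreeGE {d : ℕ} {D : JacobiDiagram m n} (h : d ≤ D.degree) :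
    cls K D ∈ degreeGE K d m n :=
  Submodule.subset_span ⟨D, h, rfl⟩

theorem single_mem_chainsGE {d : ℕ} {D : JacobiDiagram m n} (h : d ≤ D.degree) (a : K) :
    Finsupp.single D a ∈ chainsGE K d m n :=
  Finsupp.single_mem_supported K a h

theorem chainsGE_anti {d d' : ℕ} (h : d ≤ d') : chainsGE K d' m n ≤ chainsGE K d m n :=
  Finsupp.supported_mono fun _ hD => le_trans h hD

theorem degreeGE_anti {d d' : ℕ} (h : d ≤ d') : degreeGE K d' m n ≤ degreeGE K d m n := by
  rw [degreeGE_eq_map, degreeGE_eq_map]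
  exact Submodule.map_mono (chainsGE_anti h)

/-! ### Composition is bilinear and additive in the degree -/

variable (K m n p) in
/-- Stacking as a bilinear map. -/
noncomputable def stackBilin : Chains K n p →ₗ[K] Chains K m n →ₗ[K] Chains K m p :=
  Finsupp.linearCombination K fun D' : JacobiDiagram n p =>
    Finsupp.linearCombination K fun D : JacobiDiagram m n => (stackDiagram D' D : Chains K m p)

theorem stackBilin_apply (φ : Chains K n p) (ξ : Chains K m n) :
    stackBilin K m n p φ ξ = stack φ ξ := by
  simp only [stackBilin, stack, Finsupp.linearCombination_apply, Finsupp.sum,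
    LinearMap.sum_apply, LinearMap.smul_apply, Finset.smul_sum, mul_smul]

/-- The action of chains on chains, with values in morphisms. -/
noncomputable def act (φ : Chains K n p) : Chains K m n →ₗ[K] Hom K m p :=
  (relations K m p).mkQ ∘ₗ stackBilin K m n p φ

theorem act_apply (φ : Chains K n p) (ξ : Chains K m n) :
    act φ ξ = (relations K m p).mkQ (stack φ ξ) := by
  rw [act, LinearMap.comp_apply, stackBilin_apply]

theorem act_single_single (D' : JacobiDiagram n p) (D : JacobiDiagram m n) :
    act (Finsupp.single D' (1 : K)) (Finsupp.single D 1) =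
      (relations K m p).mkQ (stackDiagram D' D) := by
  simp [act, stackBilin]

theorem act_sub_left (φ ψ : Chains K n p) (ξ : Chains K m n) :
    act (φ - ψ) ξ = act φ ξ - act ψ ξ := by
  simp [act]

theorem stackDiagram_mem_chainsGE (D' : JacobiDiagram n p) (D : JacobiDiagram m n) :
    (stackDiagram D' D : Chains K m p) ∈ chainsGE K (D'.degree + D.degree) m p :=
  Submodule.sum_mem _ fun s _ => Submodule.smul_mem _ _
    (single_mem_chainsGE (degree_glue D' D s).ge 1)

theorem act_mem_degreeGE {k d : ℕ} {φ : Chains K n p} {ξ : Chains K m n}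
    (hφ : φ ∈ chainsGE K k n p) (hξ : ξ ∈ chainsGE K d m n) : act φ ξ ∈ degreeGE K (k + d) m p := by
  rw [act_apply]
  refine mkQ_mem_degreeGE ?_
  refine Submodule.sum_mem _ fun D' hD' => Submodule.sum_mem _ fun D hD => Submodule.smul_mem _ _ ?_
  refine chainsGE_anti ?_ (stackDiagram_mem_chainsGE D' D)
  exact add_le_add ((Finsupp.mem_supported K φ).1 hφ hD') ((Finsupp.mem_supported K ξ).1 hξ hD)

theorem chainsGE_zero (φ : Chains K m n) : φ ∈ chainsGE K 0 m n :=
  (Finsupp.mem_supported K φ).2 fun _ _ => Nat.zero_le _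

end

namespace RawDiagram

variable {m n p : ℕ}

/-! ### Which arcs are joined by an edge -/

/-- Some edge has its ends on the arcs `i` and `j`. -/
def ArcsJoined (D : RawDiagram m n) (i j : Fin n) : Prop :=
  ∃ e ∈ D.edge, (e.1 ∈ legNames (D.arc i) ∧ e.2.2 ∈ legNames (D.arc j)) ∨
    (e.2.2 ∈ legNames (D.arc i) ∧ e.1 ∈ legNames (D.arc j))

theorem mem_legNames {L : List (Item m)} {h : ℕ} : h ∈ legNames L ↔ Item.leg h ∈ L := by
  simp only [legNames, List.mem_filterMap]
  constructor
  · rintro ⟨a, ha, h'⟩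
    cases a <;> simp_all
  · exact fun h' => ⟨_, h', rfl⟩

/-- The relation sees only which half-edges lie on which arc and which pairs of them form edges, not
the orders, words or directions. All moves except renaming preserve these data. -/
theorem joined_congr {D D' : RawDiagram m n}
    (harc : ∀ i h, h ∈ legNames (D.arc i) ↔ h ∈ legNames (D'.arc i))
    (hedge : ∀ a b, (∃ w, (a, w, b) ∈ D.edge ∨ (b, w, a) ∈ D.edge) ↔
      ∃ w, (a, w, b) ∈ D'.edge ∨ (b, w, a) ∈ D'.edge) (i j : Fin n) :
    D.ArcsJoined i j ↔ D'.ArcsJoined i j := by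
  have key : ∀ E : RawDiagram m n, E.ArcsJoined i j ↔ ∃ a b, a ∈ legNames (E.arc i) ∧
      b ∈ legNames (E.arc j) ∧ ∃ w, (a, w, b) ∈ E.edge ∨ (b, w, a) ∈ E.edge := by
    intro E
    constructor
    · rintro ⟨⟨a, w, b⟩, he, ⟨h1, h2⟩ | ⟨h1, h2⟩⟩
      · exact ⟨a, b, h1, h2, w, Or.inl he⟩
      · exact ⟨b, a, h1, h2, w, Or.inr he⟩
    · rintro ⟨a, b, h1, h2, w, he | he⟩
      · exact ⟨_, he, Or.inl ⟨h1, h2⟩⟩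
      · exact ⟨_, he, Or.inr ⟨h1, h2⟩⟩
  simp only [key, harc, hedge]

theorem mem_legNames_update {arc : Fin n → List (Item m)} {j : Fin n} {L L' : List (Item m)}
    (hL : ∀ h, Item.leg h ∈ L ↔ Item.leg h ∈ L') (i : Fin n) (h : ℕ) :
    h ∈ legNames (Function.update arc j L i) ↔ h ∈ legNames (Function.update arc j L' i) := by
  by_cases hi : i = j
  · subst hi
    simp only [Function.update_self, mem_legNames, hL]
  · simp only [Function.update_of_ne hi]

theorem mem_legNames_rename {f : ℕ → ℕ} {L : List (Item m)} {h : ℕ} :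
    h ∈ legNames (L.map (renameItem f)) ↔ ∃ k ∈ legNames L, f k = h := by
  simp only [mem_legNames, List.mem_map]
  constructor
  · rintro ⟨a, ha, h'⟩
    cases a with
    | leg k => exact ⟨k, ha, by simpa [renameItem] using h'⟩
    | pass x => simp [renameItem] at h'
  · rintro ⟨k, hk, rfl⟩
    exact ⟨_, hk, rfl⟩

theorem ArcsJoined.rename {D : RawDiagram m n} {f : ℕ → ℕ} (hf : Function.Injective f) (i j : Fin n) :
    D.ArcsJoined i j ↔ (D.rename f).ArcsJoined i j := by
  simp only [ArcsJoined, RawDiagram.rename, mem_legNames_rename, List.mem_map, exists_exists_and_eq_and,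
    renameEdge, hf.eq_iff, exists_eq_right]

theorem Move.joined_iff {D D' : RawDiagram m n} (h : Move D D') (i j : Fin n) :
    D.ArcsJoined i j ↔ D'.ArcsJoined i j := by
  cases h with
  | rename _ f hf => exact ArcsJoined.rename hf i j
  | perm arc ht he =>
    refine joined_congr ?_ ?_ i j
    · exact fun _ _ => Iff.rfl
    · exact fun a b => by simp only [he.mem_iff]
  | rotate arc a b c t e => exact joined_congr (fun _ _ => Iff.rfl) (fun a b => Iff.rfl) i j
  | flip arc t a b w e =>
    refine joined_congr ?_ ?_ i j
    · exact fun _ _ => Iff.rfl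
    intro c d
    simp only [List.mem_cons, Prod.mk.injEq]
    constructor
    · rintro ⟨v, (⟨rfl, rfl, rfl⟩ | h) | (⟨rfl, rfl, rfl⟩ | h)⟩
      · exact ⟨_, Or.inr (Or.inl ⟨rfl, rfl, rfl⟩)⟩
      · exact ⟨_, Or.inl (Or.inr h)⟩
      · exact ⟨_, Or.inl (Or.inl ⟨rfl, rfl, rfl⟩)⟩
      · exact ⟨_, Or.inr (Or.inr h)⟩
    · rintro ⟨v, (⟨rfl, rfl, rfl⟩ | h) | (⟨rfl, rfl, rfl⟩ | h)⟩
      · exact ⟨_, Or.inr (Or.inl ⟨rfl, rfl, rfl⟩)⟩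
      · exact ⟨_, Or.inl (Or.inr h)⟩
      · exact ⟨_, Or.inl (Or.inl ⟨rfl, rfl, rfl⟩)⟩
      · exact ⟨_, Or.inr (Or.inr h)⟩
  | arcWord arc k u v w w' hw t e =>
    refine joined_congr ?_ ?_ i j
    · exact mem_legNames_update fun h => by simp
    · exact fun a b => Iff.rfl
  | edgeWord arc t a b w w' hw e =>
    refine joined_congr ?_ ?_ i j
    · exact fun _ _ => Iff.rfl
    intro c d
    simp only [List.mem_cons, Prod.mk.injEq]
    constructor
    · rintro ⟨v, (⟨rfl, rfl, rfl⟩ | h) | (⟨rfl, rfl, rfl⟩ | h)⟩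
      · exact ⟨_, Or.inl (Or.inl ⟨rfl, rfl, rfl⟩)⟩
      · exact ⟨_, Or.inl (Or.inr h)⟩
      · exact ⟨_, Or.inr (Or.inl ⟨rfl, rfl, rfl⟩)⟩
      · exact ⟨_, Or.inr (Or.inr h)⟩
    · rintro ⟨v, (⟨rfl, rfl, rfl⟩ | h) | (⟨rfl, rfl, rfl⟩ | h)⟩
      · exact ⟨_, Or.inl (Or.inl ⟨rfl, rfl, rfl⟩)⟩
      · exact ⟨_, Or.inl (Or.inr h)⟩
      · exact ⟨_, Or.inr (Or.inl ⟨rfl, rfl, rfl⟩)⟩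
      · exact ⟨_, Or.inr (Or.inr h)⟩
  | dragLeg arc k u v h x t e =>
    refine joined_congr ?_ ?_ i j
    · exact mem_legNames_update fun h => by simp
    intro a b
    exact mem_map_dragEdge_iff x _ e a b
  | dragTri arc a b c x t e =>
    refine joined_congr ?_ ?_ i j
    · exact fun _ _ => Iff.rfl
    · exact fun c d => mem_map_dragEdge_iff x _ e c d
where
  mem_map_dragEdge_iff (x : Letter m) (s : Finset ℕ) (e : List (Edge m)) (a b : ℕ) :
      (∃ w, (a, w, b) ∈ e ∨ (b, w, a) ∈ e) ↔
        ∃ w, (a, w, b) ∈ e.map (dragEdge x s) ∨ (b, w, a) ∈ e.map (dragEdge x s) := by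
    constructor
    · rintro ⟨w, h | h⟩
      · exact ⟨_, Or.inl (List.mem_map_of_mem (f := dragEdge x s) h)⟩
      · exact ⟨_, Or.inr (List.mem_map_of_mem (f := dragEdge x s) h)⟩
    · simp only [List.mem_map, dragEdge]
      rintro ⟨w, ⟨⟨a', v, b'⟩, h, h'⟩ | ⟨⟨a', v, b'⟩, h, h'⟩⟩
      · simp only [Prod.mk.injEq] at h'
        obtain ⟨rfl, -, rfl⟩ := h'
        exact ⟨v, Or.inl h⟩
      · simp only [Prod.mk.injEq] at h'
        obtain ⟨rfl, -, rfl⟩ := h'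
        exact ⟨v, Or.inr h⟩

theorem Move.length_tri {D D' : RawDiagram m n} (h : Move D D') :
    D.tri.length = D'.tri.length := by
  cases h with
  | perm arc ht he => exact ht.length_eq
  | _ => simp [RawDiagram.rename]

theorem Move.length_edge {D D' : RawDiagram m n} (h : Move D D') :
    D.edge.length = D'.edge.length := by
  cases h with
  | perm arc ht he => exact he.length_eq
  | _ => simp [RawDiagram.rename]

theorem STU.tri_ne_nil {S T U : RawDiagram m n} (h : STU S T U) : S.tri ≠ [] := by
  cases h
  simp

theorem STU.tri_eq {S T U : RawDiagram m n} (h : STU S T U) : T.tri = U.tri := by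
  cases h
  rfl

theorem STU.edge_eq {S T U : RawDiagram m n} (h : STU S T U) : T.edge = U.edge := by
  cases h
  rfl

/-- `T` and `U` differ by the order of two neighbours on one arc, which the relation forgets. -/
theorem STU.joined_iff {S T U : RawDiagram m n} (h : STU S T U) (i j : Fin n) :
    T.ArcsJoined i j ↔ U.ArcsJoined i j := by
  cases h
  refine joined_congr ?_ ?_ i j
  · refine mem_legNames_update fun h => ?_
    simp only [List.mem_append, List.mem_cons]
    tauto
  · exact fun a b => Iff.rfl

end RawDiagram

/-! ### Linear forms that count chord diagrams by the arcs they join -/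

section

variable (K : Type*) [Field K] {m n p : ℕ}

open Classical in
/-- The indicator of the chord diagrams with `k` chords such that the relation of being joined by a
chord on the set of arcs satisfies `P`. -/
noncomputable def chordIndicator (k : ℕ) (P : (Fin n → Fin n → Prop) → Prop)
    (D : JacobiDiagram m n) : K :=
  if D.1.tri = [] ∧ D.1.edge.length = k ∧ P D.1.ArcsJoined then 1 else 0

theorem chordIndicator_congr {m' n' k k' : ℕ} {P : (Fin n → Fin n → Prop) → Prop}
    {P' : (Fin n' → Fin n' → Prop) → Prop} {D : JacobiDiagram m n} {D' : JacobiDiagram m' n'}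
    (h1 : D.1.tri = [] ↔ D'.1.tri = []) (h2 : D.1.edge.length = k ↔ D'.1.edge.length = k')
    (h3 : P D.1.ArcsJoined ↔ P' D'.1.ArcsJoined) :
    chordIndicator K k P D = chordIndicator K k' P' D' := by
  classical
  exact if_congr (and_congr h1 (and_congr h2 h3)) rfl rfl

/-- The linear form on morphisms that extends `chordIndicator`. -/
noncomputable def chordForm (m : ℕ) (k : ℕ) (P : (Fin n → Fin n → Prop) → Prop) :
    Hom K m n →ₗ[K] K :=
  (relations K m n).liftQ (Finsupp.linearCombination K (chordIndicator K k P)) <| by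
    rw [relations, Submodule.span_le]
    rintro c (⟨D, D', h, rfl⟩ | ⟨S, T, U, h, rfl⟩)
    · have h1 : D.1.tri = [] ↔ D'.1.tri = [] := by
        rw [← List.length_eq_zero_iff, ← List.length_eq_zero_iff, h.length_tri]
      have h2 : D.1.ArcsJoined = D'.1.ArcsJoined := by
        ext i j
        exact h.joined_iff i j
      have h3 : chordIndicator K k P D = chordIndicator K k P D' :=
        chordIndicator_congr K h1 (by rw [h.length_edge]) (by rw [h2])
      simp [h3]
    -- The first term of STU has a trivalent vertex and is not counted; the other two are counted
    -- equally and cancel.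
    · have hS : chordIndicator K k P S = 0 := if_neg fun h' => h.tri_ne_nil h'.1
      have hTU : chordIndicator K k P T = chordIndicator K k P U := by
        have h2 : T.1.ArcsJoined = U.1.ArcsJoined := by
          ext i j
          exact h.joined_iff i j
        exact chordIndicator_congr K (by rw [h.tri_eq]) (by rw [h.edge_eq]) (by rw [h2])
      simp [hS, hTU]

variable {K}

theorem chordForm_mkQ (k : ℕ) (P : (Fin n → Fin n → Prop) → Prop) (ξ : Chains K m n) :
    chordForm K m k P ((relations K m n).mkQ ξ) = ξ.sum fun D a => a * chordIndicator K k P D := by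
  rw [chordForm, Submodule.mkQ_apply, Submodule.liftQ_apply, Finsupp.linearCombination_apply]
  rfl

theorem chordForm_cls (k : ℕ) (P : (Fin n → Fin n → Prop) → Prop) (D : JacobiDiagram m n) :
    chordForm K m k P (cls K D) = chordIndicator K k P D := by
  rw [cls, chordForm_mkQ]
  simp

theorem chordIndicator_eq_zero {k : ℕ} {P : (Fin n → Fin n → Prop) → Prop} {D : JacobiDiagram m n}
    (h : D.degree ≠ k) : chordIndicator K k P D = 0 := by
  rw [chordIndicator, if_neg]
  rintro ⟨h1, h2, -⟩
  have := D.degree_add_length_tri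
  rw [h1, h2] at this
  exact h this

/-- A chord diagram with `k` chords has degree exactly `k`. -/
theorem chordForm_eq_zero {k d : ℕ} (hk : k < d) {P : (Fin n → Fin n → Prop) → Prop}
    {x : Hom K m n} (hx : x ∈ degreeGE K d m n) : chordForm K m k P x = 0 := by
  have h : degreeGE K d m n ≤ LinearMap.ker (chordForm K m k P) := by
    rw [degreeGE, Submodule.span_le]
    rintro _ ⟨D, hD, rfl⟩
    exact (chordForm_cls k P D).trans (chordIndicator_eq_zero (by omega))
  exact h hx

end

/-! ### Identifications between diagrams without handles -/

namespace RawDiagram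

variable {m n p : ℕ}

/-- Being a Jacobi diagram only depends on the half-edges and their incidences. -/
theorem IsJacobi.congr {D D' : RawDiagram m n} (hD : D.IsJacobi) (h1 : D.legs = D'.legs)
    (h2 : (D.tri.map triNames).Perm (D'.tri.map triNames))
    (h3 : (D.edge.map edgeNames).Perm (D'.edge.map edgeNames)) : D'.IsJacobi := by
  have ht : D.triHalf = D'.triHalf := h2.sum_eq
  have he : D.edgeHalf = D'.edgeHalf := h3.sum_eq
  have hl : ∀ h k, D.Linked h k → D'.Linked h k := by
    rintro h k (⟨e, he, h', k'⟩ | ⟨t, ht, h', k'⟩)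
    · obtain ⟨e', he', hee⟩ := List.mem_map.1 (h3.mem_iff.1 (List.mem_map_of_mem he))
      exact Or.inl ⟨e', he', hee ▸ h', hee ▸ k'⟩
    · obtain ⟨e', he', hee⟩ := List.mem_map.1 (h2.mem_iff.1 (List.mem_map_of_mem ht))
      exact Or.inr ⟨e', he', hee ▸ h', hee ▸ k'⟩
  refine ⟨by rw [← h1, ← ht]; exact hD.nodup, by rw [← h1, ← ht, ← he]; exact hD.matched, ?_⟩
  intro h hh
  rw [← he] at hh
  obtain ⟨l, hl', hc⟩ := hD.anchored h hh
  exact ⟨l, h1 ▸ hl', ReflTransGen.mono hl _ _ hc⟩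

/-- A diagram all of whose half-edges are univalent vertices is anchored. -/
theorem IsJacobi.of_tri_eq_nil {D : RawDiagram m n} (ht : D.tri = []) (h1 : D.legs.Nodup)
    (h2 : D.edgeHalf = D.legs) : D.IsJacobi := by
  have h : D.triHalf = 0 := by simp [triHalf, ht]
  refine ⟨by rwa [h, add_zero], by rwa [h, add_zero], fun k hk => ⟨k, h2 ▸ hk, .refl⟩⟩

theorem IsJacobi.edgeHalf_eq_legs {D : RawDiagram m n} (hD : D.IsJacobi) (ht : D.tri = []) :
    D.edgeHalf = D.legs := by
  have h : D.triHalf = 0 := by simp [triHalf, ht]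
  rw [hD.matched, h, add_zero]

theorem legNames_rename (f : ℕ → ℕ) (L : List (Item m)) :
    legNames (L.map (renameItem f)) = (legNames L).map f := by
  induction L with
  | nil => rfl
  | cons a L ih => cases a <;> simp_all [legNames, renameItem]

theorem IsJacobi.rename {D : RawDiagram m n} (hD : D.IsJacobi) {f : ℕ → ℕ}
    (hf : Function.Injective f) : (D.rename f).IsJacobi := by
  have h1 : (D.rename f).legs = D.legs.map f := by
    rw [legs, legs, ← Multiset.coe_mapAddMonoidHom, map_sum]
    refine Finset.sum_congr rfl fun j _ => ?_
    rw [RawDiagram.rename, legNames_rename]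
    rfl
  have h2 : (D.rename f).triHalf = D.triHalf.map f := sum_triNames_rename f _
  have h3 : (D.rename f).edgeHalf = D.edgeHalf.map f := sum_edgeNames_rename f _
  refine ⟨?_, ?_, ?_⟩
  · rw [h1, h2, ← Multiset.map_add]
    exact hD.nodup.map hf
  · rw [h1, h2, h3, ← Multiset.map_add, hD.matched]
  · intro h hh
    rw [h3] at hh
    obtain ⟨k, hk, rfl⟩ := Multiset.mem_map.1 hh
    obtain ⟨l, hl, hc⟩ := hD.anchored k hk
    refine ⟨f l, h1 ▸ Multiset.mem_map_of_mem f hl, hc.lift f ?_⟩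
    rintro a b (⟨e, he, h', k'⟩ | ⟨t, ht, h', k'⟩)
    · refine Or.inl ⟨renameEdge f e, List.mem_map_of_mem he, ?_⟩
      simp only [edgeNames, Multiset.insert_eq_cons, Multiset.mem_cons,
        Multiset.mem_singleton, renameEdge] at h' k' ⊢
      exact ⟨h'.imp (congrArg f) (congrArg f), k'.imp (congrArg f) (congrArg f)⟩
    · refine Or.inr ⟨renameTri f t, List.mem_map_of_mem ht, ?_⟩
      simp only [triNames, Multiset.insert_eq_cons, Multiset.mem_cons,
        Multiset.mem_singleton, renameTri] at h' k' ⊢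
      exact ⟨h'.imp (congrArg f) (Or.imp (congrArg f) (congrArg f)),
        k'.imp (congrArg f) (Or.imp (congrArg f) (congrArg f))⟩

theorem word_eq_nil (w : List (Letter 0)) : w = [] := by
  cases w with
  | nil => rfl
  | cons x _ => exact x.1.elim0

/-- Write an edge with the smaller half-edge first. -/
def sortEdge (e : Edge 0) : Edge 0 := if e.1 ≤ e.2.2 then e else (e.2.2, [], e.1)

theorem edgeNames_sortEdge (e : Edge 0) : edgeNames (sortEdge e) = edgeNames e := by
  unfold sortEdge
  split_ifs
  · rfl
  · exact Multiset.pair_comm _ _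

theorem map_edgeNames_sortEdge (E : List (Edge 0)) :
    (E.map sortEdge).map edgeNames = E.map edgeNames := by
  rw [List.map_map]
  exact List.map_congr_left fun e _ => edgeNames_sortEdge e

end RawDiagram

section

variable (K : Type*) [Field K] {m n p : ℕ}

open RawDiagram

theorem cls_eq_of_perm {D D' : JacobiDiagram m n} (h1 : D.1.arc = D'.1.arc)
    (h2 : D.1.tri.Perm D'.1.tri) (h3 : D.1.edge.Perm D'.1.edge) : cls K D = cls K D' := by
  obtain ⟨⟨arc, t, e⟩, hD⟩ := D
  obtain ⟨⟨arc', t', e'⟩, hD'⟩ := D'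
  obtain rfl : arc = arc' := h1
  exact cls_eq_of_move K (Move.perm arc h2 h3)

theorem cls_rename (D : JacobiDiagram m n) {f : ℕ → ℕ} (hf : Function.Injective f) :
    cls K (⟨D.1.rename f, D.2.rename hf⟩ : JacobiDiagram m n) = cls K D :=
  (cls_eq_of_move K (Move.rename D.1 f hf)).symm

/-- Reversing one edge in the middle of the list. -/
theorem cls_eq_of_flip {arc : Fin n → List (Item 0)} {t : List (ℕ × ℕ × ℕ)} {E E' : List (Edge 0)}
    {a b : ℕ} (hD : IsJacobi ⟨arc, t, E ++ (a, [], b) :: E'⟩)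
    (hD' : IsJacobi ⟨arc, t, E ++ (b, [], a) :: E'⟩) :
    cls K (⟨_, hD⟩ : JacobiDiagram 0 n) = cls K (⟨_, hD'⟩ : JacobiDiagram 0 n) := by
  have h1 : IsJacobi ⟨arc, t, (a, [], b) :: (E ++ E')⟩ :=
    hD.congr rfl (.refl _) (List.perm_middle.map _)
  have h2 : IsJacobi ⟨arc, t, (b, [], a) :: (E ++ E')⟩ :=
    hD'.congr rfl (.refl _) (List.perm_middle.map _)
  have e1 : cls K (⟨_, hD⟩ : JacobiDiagram 0 n) = cls K (⟨_, h1⟩ : JacobiDiagram 0 n) :=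
    cls_eq_of_perm K rfl (.refl _) List.perm_middle
  have e2 : cls K (⟨_, hD'⟩ : JacobiDiagram 0 n) = cls K (⟨_, h2⟩ : JacobiDiagram 0 n) :=
    cls_eq_of_perm K rfl (.refl _) List.perm_middle
  rw [e1, e2]
  exact cls_eq_of_move K (Move.flip arc t a b [] (E ++ E'))

/-- Without handles an edge can be reversed at no cost, which gives a normal form for the edges up
to their order. The prefix `E` collects the edges already treated. -/
theorem cls_sortEdge {arc : Fin n → List (Item 0)} {t : List (ℕ × ℕ × ℕ)} (E' E : List (Edge 0))
    (hD : IsJacobi ⟨arc, t, E ++ E'⟩) (hD' : IsJacobi ⟨arc, t, E ++ E'.map sortEdge⟩) :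
    cls K (⟨_, hD⟩ : JacobiDiagram 0 n) = cls K (⟨_, hD'⟩ : JacobiDiagram 0 n) := by
  induction E' generalizing E with
  | nil => rfl
  | cons e E' ih =>
    have h1 : IsJacobi ⟨arc, t, E ++ sortEdge e :: E'⟩ :=
      hD.congr rfl (.refl _) (by simp [edgeNames_sortEdge])
    have e1 : cls K (⟨_, hD⟩ : JacobiDiagram 0 n) = cls K (⟨_, h1⟩ : JacobiDiagram 0 n) := by
      obtain ⟨a, w, b⟩ := e
      obtain rfl := word_eq_nil w
      by_cases hab : a ≤ b
      · have : sortEdge ((a, [], b) : Edge 0) = (a, [], b) := if_pos hab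
        simp only [this]
      · have : sortEdge ((a, [], b) : Edge 0) = (b, [], a) := if_neg hab
        simp only [this] at h1 ⊢
        exact cls_eq_of_flip K hD h1
    rw [e1]
    have h2 : IsJacobi ⟨arc, t, (E ++ [sortEdge e]) ++ E'⟩ := by
      simpa using h1
    have h3 : IsJacobi ⟨arc, t, (E ++ [sortEdge e]) ++ E'.map sortEdge⟩ := by
      simpa using hD'
    have := ih (E ++ [sortEdge e]) h2 h3
    simpa using this

end

namespace RawDiagram

variable {m n p : ℕ}

/-! ### Stacking on a diagram that passes each handle at most once -/

/-- Only the arcs pass handles, in positive direction, and each handle is passed at most once. -/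
structure IsSimple (f : RawDiagram n p) : Prop where
  word_nil : ∀ e ∈ f.edge, e.2.1 = []
  pos : ∀ j x, Item.pass x ∈ f.arc j → x.2 = true
  once : ∀ (j j' : Fin p) (k k' : ℕ) (x x' : Letter n), (f.arc j)[k]? = some (Item.pass x) →
    (f.arc j')[k']? = some (Item.pass x') → x.1 = x'.1 → j = j' ∧ k = k'

theorem IsSimple.mem_passages {f : RawDiagram n p} (hf : f.IsSimple) {o : Passage n p} :
    o ∈ f.passages ↔ ∃ j k x, (f.arc j)[k]? = some (Item.pass x) ∧ o = (Sum.inl j, k, x) := by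
  have h : f.edgePassages = [] := by
    rw [edgePassages, List.flatMap_eq_nil_iff]
    rintro ⟨e, q⟩ he
    simp [hf.word_nil e (List.fst_mem_of_mem_zipIdx he)]
  rw [passages, h, List.append_nil, arcPassages]
  simp only [List.mem_flatMap, List.mem_filterMap, List.mem_finRange, true_and]
  constructor
  · rintro ⟨j, ⟨a, k⟩, ha, ho⟩
    rw [List.mem_zipIdx_iff_getElem?] at ha
    cases a with
    | leg h => simp at ho
    | pass x => exact ⟨j, k, x, ha, (Option.some_injective _ ho).symm⟩
  · rintro ⟨j, k, x, hx, rfl⟩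
    exact ⟨j, (Item.pass x, k), List.mem_zipIdx_iff_getElem?.2 hx, rfl⟩

/-- There is at most one parallel copy of each arc, so the sum over placements has at most one term.
-/
theorem IsSimple.passage_ext {f : RawDiagram n p} (hf : f.IsSimple) {o o' : Passage n p}
    (ho : o ∈ f.passages) (ho' : o' ∈ f.passages) (h : o.2.2.1 = o'.2.2.1) : o = o' := by
  obtain ⟨j, k, x, hx, rfl⟩ := hf.mem_passages.1 ho
  obtain ⟨j', k', x', hx', rfl⟩ := hf.mem_passages.1 ho'
  obtain ⟨rfl, rfl⟩ := hf.once _ _ _ _ _ _ hx hx' h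
  rw [hx] at hx'
  cases hx'
  rfl

/-- Replace each passage of `f` through a handle by the corresponding arc of `D`. -/
def substitute (f : RawDiagram n p) (D : RawDiagram m n) : RawDiagram m p where
  arc j := (f.arc j).flatMap fun
    | Item.leg h => [Item.leg (4 * h)]
    | Item.pass x => (D.arc x.1).map (renameItem fun h => 4 * h + 1)
  tri := f.tri.map (renameTri fun h => 4 * h) ++ D.tri.map (renameTri fun h => 4 * h + 1)
  edge := f.edge.map (fun e => (4 * e.1, [], 4 * e.2.2)) ++ D.edge.map (renameEdge fun h => 4 * h + 1)

theorem strand_eq_map {D : RawDiagram m n} {s : ℕ → Option (Passage n p)} {o : Passage n p}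
    (ho : o.2.2.2 = true) (hs : ∀ h ∈ legNames (D.arc o.2.2.1), s h = some o) :
    D.strand s o = (D.arc o.2.2.1).map (renameItem fun h => 4 * h + 1) := by
  simp only [strand, ho, if_true]
  generalize D.arc o.2.2.1 = L at hs
  induction L with
  | nil => rfl
  | cons a L ih =>
    cases a with
    | leg h =>
      have h1 : s h = some o := hs h (by simp [legNames])
      simp only [List.filterMap_cons, h1, if_true, List.map_cons, renameItem]
      rw [ih fun k hk => hs k (by simp [legNames] at hk ⊢; exact Or.inr hk)]
    | pass x =>
      simp only [List.filterMap_cons, List.map_cons, renameItem]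
      rw [ih fun k hk => hs k hk]

theorem flatMap_zipIdx_fst {α β : Type*} (l : List α) (g : α → List β) :
    (l.zipIdx.flatMap fun y => g y.1) = l.flatMap g := by
  conv_rhs => rw [← List.zipIdx_map_fst 0 l, List.flatMap_map]

/-- The edges of `f` pass no handle, so no univalent vertex of `D` lands on an edge and no trivalent
vertex is created. By `hs`, each copy of an arc keeps all its univalent vertices. -/
theorem IsSimple.glue_eq_substitute {f : RawDiagram n p} (hf : f.IsSimple) {D : RawDiagram m n}
    {s : ℕ → Option (Passage n p)}
    (hs : ∀ o ∈ f.passages, ∀ h ∈ legNames (D.arc o.2.2.1), s h = some o) :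
    glue f D s = substitute f D := by
  have hw : ∀ y ∈ f.edge.zipIdx, y.1.2.1 = [] := fun y hy =>
    hf.word_nil _ (List.fst_mem_of_mem_zipIdx hy)
  have h1 : (f.edge.zipIdx.flatMap fun y => splitTri (D.edgeItems s y.2 y.1.2.1)) = [] := by
    rw [List.flatMap_eq_nil_iff]
    intro y hy
    rw [hw y hy]
    rfl
  have h2 : (f.edge.zipIdx.flatMap fun y =>
      splitEdge (4 * y.1.1) [] (D.edgeItems s y.2 y.1.2.1) (4 * y.1.2.2)) =
      f.edge.map fun e => ((4 * e.1, [], 4 * e.2.2) : Edge m) := by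
    rw [List.map_eq_flatMap, ← flatMap_zipIdx_fst f.edge]
    refine List.flatMap_congr fun y hy => ?_
    rw [hw y hy]
    rfl
  refine RawDiagram.ext ?_ ?_ ?_
  · funext j
    simp only [glue, substitute]
    rw [← flatMap_zipIdx_fst (f.arc j)]
    refine List.flatMap_congr fun y hy => ?_
    obtain ⟨a, k⟩ := y
    rw [List.mem_zipIdx_iff_getElem?] at hy
    cases a with
    | leg h => rfl
    | pass x =>
      exact strand_eq_map (hf.pos j x (List.mem_of_getElem? hy))
        (hs _ (hf.mem_passages.2 ⟨j, k, x, hy, rfl⟩))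
  · simp only [glue, substitute, h1, List.append_nil]
  · simp only [glue, substitute, h2]

theorem arc_eq_of_mem_legNames {D : RawDiagram m n} (hD : D.legs.Nodup) {h : ℕ} {i j : Fin n}
    (hi : h ∈ legNames (D.arc i)) (hj : h ∈ legNames (D.arc j)) : i = j := by
  by_contra hij
  have hle : (legNames (D.arc i) : Multiset ℕ) + (legNames (D.arc j) : Multiset ℕ) ≤ D.legs := by
    rw [legs, ← Finset.sum_pair (f := fun j => (legNames (D.arc j) : Multiset ℕ)) hij]
    exact Finset.sum_le_sum_of_subset (Finset.subset_univ _)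
  have := Multiset.nodup_of_le hle hD
  rw [Multiset.nodup_add, Multiset.disjoint_left] at this
  exact this.2.2 hi hj

theorem nodup_legNames {D : RawDiagram m n} (hD : D.legs.Nodup) (j : Fin n) :
    (legNames (D.arc j)).Nodup := by
  rw [← Multiset.coe_nodup]
  refine Multiset.nodup_of_le ?_ hD
  exact Finset.single_le_sum (f := fun j => (legNames (D.arc j) : Multiset ℕ))
    (fun _ _ => Multiset.zero_le _) (Finset.mem_univ j)

theorem IsJacobi.nodup_legs {D : RawDiagram m n} (hD : D.IsJacobi) : D.legs.Nodup :=
  (Multiset.nodup_add.1 hD.nodup).1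

end RawDiagram

section

open RawDiagram

variable (K : Type*) [Field K] {m n p : ℕ}

/-- A univalent vertex on the `i`-th arc has no copy to be put on: the sum over placements is empty.
-/
theorem stackDiagram_eq_zero {f : JacobiDiagram n p} (hf : f.1.IsSimple) {D : JacobiDiagram m n}
    {i : Fin n} (hi : legNames (D.1.arc i) ≠ []) (hno : ∀ j x, Item.pass x ∈ f.1.arc j → x.1 ≠ i) :
    (stackDiagram f D : Chains K m p) = 0 := by
  have : IsEmpty (Placement f.1 D.1) := by
    refine ⟨fun s => ?_⟩
    obtain ⟨h, hh⟩ := List.exists_mem_of_ne_nil _ hi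
    obtain ⟨o, ho, -, ho'⟩ := s.toFun_spec (mem_legs.2 ⟨i, hh⟩)
    obtain ⟨j, k, x, hx, rfl⟩ := hf.mem_passages.1 ho
    exact hno j x (List.mem_of_getElem? hx) (arc_eq_of_mem_legNames D.2.nodup_legs ho' hh)
  rw [stackDiagram, Finset.univ_eq_empty, Finset.sum_empty]

/-- Each univalent vertex has exactly one possible place, and no copy is traversed backwards, so the
only placement has sign 1. Handles of arcs without univalent vertices need not be passed. -/
theorem stackDiagram_eq_single {f : JacobiDiagram n p} (hf : f.1.IsSimple) {D : JacobiDiagram m n}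
    (hcov : ∀ i, legNames (D.1.arc i) ≠ [] → ∃ j x, Item.pass x ∈ f.1.arc j ∧ x.1 = i) :
    ∃ hJ : (substitute f.1 D.1).IsJacobi, (stackDiagram f D : Chains K m p) =
      Finsupp.single (⟨substitute f.1 D.1, hJ⟩ : JacobiDiagram m p) 1 := by
  have hex : ∀ h : {h // h ∈ D.1.legs.toFinset}, ∃ o : {o // o ∈ f.1.passages.toFinset},
      h.1 ∈ legNames (D.1.arc o.1.2.2.1) := by
    rintro ⟨h, hh⟩
    obtain ⟨i, hi⟩ := mem_legs.1 (Multiset.mem_toFinset.1 hh)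
    obtain ⟨j, x, hx, rfl⟩ := hcov i (List.ne_nil_of_mem hi)
    obtain ⟨k, hk⟩ := List.mem_iff_getElem?.1 hx
    exact ⟨⟨_, List.mem_toFinset.2 (hf.mem_passages.2 ⟨j, k, x, hk, rfl⟩)⟩, hi⟩
  choose s0 hs0 using hex
  let s : Placement f.1 D.1 := ⟨s0, hs0⟩
  have huniq : ∀ t : Placement f.1 D.1, t = s := by
    intro t
    refine Subtype.ext (funext fun h => Subtype.ext ?_)
    exact hf.passage_ext (List.mem_toFinset.1 (t.1 h).2) (List.mem_toFinset.1 (s.1 h).2)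
      (arc_eq_of_mem_legNames D.2.nodup_legs (t.2 h) (s.2 h))
  have hglue : glue f.1 D.1 s.toFun = substitute f.1 D.1 := by
    refine hf.glue_eq_substitute fun o ho h hh => ?_
    obtain ⟨o', ho', h1, h2⟩ := s.toFun_spec (mem_legs.2 ⟨_, hh⟩)
    rw [h1, hf.passage_ext ho' ho (arc_eq_of_mem_legNames D.2.nodup_legs h2 hh)]
  have hsign : s.sign = 1 := by
    refine Finset.prod_eq_one fun h _ => ?_
    obtain ⟨j, k, x, hx, ho⟩ := hf.mem_passages.1 (List.mem_toFinset.1 (s.1 h).2)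
    rw [if_pos]
    rw [ho]
    exact hf.pos j x (List.mem_of_getElem? hx)
  have hJ : (substitute f.1 D.1).IsJacobi := hglue ▸ isJacobi_glue f.2 D.2 s
  refine ⟨hJ, ?_⟩
  rw [stackDiagram, Fintype.sum_eq_single s fun t ht => absurd (huniq t) ht, hsign, Int.cast_one,
    one_smul]
  congr 1
  exact Subtype.ext hglue

theorem act_single_eq_zero {f : JacobiDiagram n p} (hf : f.1.IsSimple) {D : JacobiDiagram m n}
    {i : Fin n} (hi : legNames (D.1.arc i) ≠ []) (hno : ∀ j x, Item.pass x ∈ f.1.arc j → x.1 ≠ i) :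
    act (Finsupp.single f (1 : K)) (Finsupp.single D 1) = 0 := by
  rw [act_single_single, stackDiagram_eq_zero K hf hi hno, map_zero]

theorem act_single_eq_cls {f : JacobiDiagram n p} (hf : f.1.IsSimple) {D : JacobiDiagram m n}
    (hcov : ∀ i, legNames (D.1.arc i) ≠ [] → ∃ j x, Item.pass x ∈ f.1.arc j ∧ x.1 = i) :
    ∃ hJ : (substitute f.1 D.1).IsJacobi,
      act (Finsupp.single f (1 : K)) (Finsupp.single D 1) =
        cls K (⟨substitute f.1 D.1, hJ⟩ : JacobiDiagram m p) := by
  obtain ⟨hJ, h⟩ := stackDiagram_eq_single K hf hcov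
  exact ⟨hJ, by rw [act_single_single, h]; rfl⟩

end

/-! ### Omitting an arc -/

namespace RawDiagram

variable {n : ℕ}

/-- The identity, except that the `i`-th arc does not pass any handle. -/
def omitArc (i : Fin n) : RawDiagram n n where
  arc j := if j = i then [] else [Item.pass (j, true)]
  tri := []
  edge := []

theorem mem_omitArc {i j : Fin n} {a : Item n} :
    a ∈ (omitArc i).arc j ↔ j ≠ i ∧ a = Item.pass (j, true) := by
  by_cases h : j = i <;> simp [omitArc, h]

theorem isJacobi_omitArc (i : Fin n) : (omitArc i).IsJacobi := by
  have h : (omitArc i).legs = 0 := by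
    refine Finset.sum_eq_zero fun j _ => ?_
    by_cases h : j = i <;> simp [omitArc, legNames, h]
  exact .of_tri_eq_nil rfl (by simp [h]) (by rw [h]; rfl)

theorem isSimple_omitArc (i : Fin n) : (omitArc i).IsSimple where
  word_nil e he := by simp [omitArc] at he
  pos j x hx := by
    have := (mem_omitArc.1 hx).2
    cases this
    rfl
  once j j' k k' x x' hx hx' h := by
    have h1 := mem_omitArc.1 (List.mem_of_getElem? hx)
    have h2 := mem_omitArc.1 (List.mem_of_getElem? hx')
    have e1 : x = (j, true) := by simpa using h1.2
    have e2 : x' = (j', true) := by simpa using h2.2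
    subst e1 e2
    obtain rfl : j = j' := h
    simp only [omitArc, if_neg h1.1] at hx hx'
    have hk := (List.getElem?_eq_some_iff.1 hx).1
    have hk' := (List.getElem?_eq_some_iff.1 hx').1
    simp only [List.length_singleton] at hk hk'
    exact ⟨rfl, by omega⟩

theorem arc_eq_nil {L : List (Item 0)} (h : legNames L = []) : L = [] := by
  cases L with
  | nil => rfl
  | cons a L =>
    cases a with
    | leg k => simp [legNames] at h
    | pass x => exact x.1.elim0

end RawDiagram

section

open RawDiagram

variable (K : Type*) [Field K] {n : ℕ}

/-- Omitting an arc, as a morphism. -/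
def JacobiDiagram.omitArc (i : Fin n) : JacobiDiagram n n := ⟨RawDiagram.omitArc i, isJacobi_omitArc i⟩

theorem act_omitArc_of_ne_nil (i : Fin n) {D : JacobiDiagram 0 n} (h : legNames (D.1.arc i) ≠ []) :
    act (Finsupp.single (JacobiDiagram.omitArc i) (1 : K)) (Finsupp.single D 1) = 0 := by
  refine act_single_eq_zero K (isSimple_omitArc i) h fun j x hx => ?_
  have := mem_omitArc.1 hx
  cases this.2
  exact this.1

/-- In genus 0 an arc without univalent vertices is empty, so omitting it loses nothing. Gluing
renames `h` to `4 * h + 1`, which is a move. -/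
theorem act_omitArc_of_eq_nil (i : Fin n) {D : JacobiDiagram 0 n} (h : legNames (D.1.arc i) = []) :
    act (Finsupp.single (JacobiDiagram.omitArc i) (1 : K)) (Finsupp.single D 1) = cls K D := by
  have hf : Function.Injective fun h : ℕ => 4 * h + 1 := fun a b hab => by simpa using hab
  obtain ⟨hJ, e⟩ := act_single_eq_cls K (f := JacobiDiagram.omitArc i) (isSimple_omitArc i) (D := D)
    fun j hj => ⟨j, (j, true), mem_omitArc.2 ⟨fun hji => hj (hji ▸ h), rfl⟩, rfl⟩
  rw [e, ← cls_rename K D hf]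
  refine cls_eq_of_perm K (funext fun j => ?_) (.of_eq ?_) (.of_eq ?_)
  · simp only [substitute, RawDiagram.rename, JacobiDiagram.omitArc, omitArc]
    by_cases hj : j = i
    · subst hj
      simp [arc_eq_nil h]
    · simp [hj]
  · simp [substitute, RawDiagram.rename, JacobiDiagram.omitArc, omitArc]
  · simp [substitute, RawDiagram.rename, JacobiDiagram.omitArc, omitArc]

end

namespace RawDiagram

variable {m n p : ℕ}

/-! ### Reduction to chord diagrams -/

/-- A diagram with a trivalent vertex has an edge from a univalent to a trivalent vertex. -/
theorem IsJacobi.exists_leg_edge {D : RawDiagram m n} (hD : D.IsJacobi) (ht : D.tri ≠ []) :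
    ∃ h k, h ∈ D.legs ∧ k ∈ D.triHalf ∧ ∃ w, (h, w, k) ∈ D.edge ∨ (k, w, h) ∈ D.edge := by
  obtain ⟨t, htm⟩ := List.exists_mem_of_ne_nil _ ht
  have mem_tri : ∀ t ∈ D.tri, ∀ x ∈ triNames t, x ∈ D.triHalf := by
    intro t ht x hx
    exact Multiset.mem_of_le (List.single_le_sum (fun _ _ => Multiset.zero_le _) _
      (List.mem_map_of_mem ht)) hx
  have hdisj : ∀ {x}, x ∈ D.legs → x ∉ D.triHalf := fun h =>
    Multiset.disjoint_left.1 (Multiset.nodup_add.1 hD.nodup).2.2 h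
  have hx : t.1 ∈ D.triHalf := mem_tri t htm _ (by simp [triNames])
  obtain ⟨l, hl, hc⟩ := hD.anchored t.1 (by rw [hD.matched]; exact Multiset.mem_add.2 (Or.inr hx))
  clear htm
  generalize t.1 = x at hx hc
  -- On a path from a trivalent half-edge to a univalent vertex, the first step that leaves the
  -- trivalent half-edges cannot take place at a trivalent vertex, so it runs along an edge.
  induction hc using ReflTransGen.head_induction_on with
  | refl => exact absurd hx (hdisj hl)
  | @head x y hxy _ ih =>
    by_cases hy : y ∈ D.triHalf
    · exact ih hy
    rcases hxy with ⟨⟨a, w, b⟩, he, hxe, hye⟩ | ⟨t, ht, hxe, hye⟩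
    · have hyl : y ∈ D.legs := by
        have : y ∈ D.edgeHalf := mem_edgeHalf.2 ⟨_, he, hye⟩
        rw [hD.matched] at this
        exact (Multiset.mem_add.1 this).resolve_right hy
      have hne : x ≠ y := fun h => hy (h ▸ hx)
      refine ⟨y, x, hyl, hx, w, ?_⟩
      simp only [edgeNames, Multiset.insert_eq_cons, Multiset.mem_cons,
        Multiset.mem_singleton] at hxe hye
      rcases hxe with rfl | rfl <;> rcases hye with rfl | rfl
      · exact absurd rfl hne
      · exact Or.inr he
      · exact Or.inl he
      · exact absurd rfl hne
    · exact absurd (mem_tri t ht y hye) hy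

theorem mem_triHalf {D : RawDiagram m n} {h : ℕ} :
    h ∈ D.triHalf ↔ ∃ t ∈ D.tri, h ∈ triNames t := by
  unfold triHalf
  induction D.tri with
  | nil => simp
  | cons a l ih => simp [ih]

theorem legs_update (arc : Fin n → List (Item m)) (j : Fin n) (L L' : List (Item m))
    (t t' : List (ℕ × ℕ × ℕ)) (e e' : List (Edge m)) :
    RawDiagram.legs ⟨Function.update arc j L, t, e⟩ + (legNames L' : Multiset ℕ) =
      RawDiagram.legs ⟨Function.update arc j L', t', e'⟩ + (legNames L : Multiset ℕ) := by
  have key : ∀ L : List (Item m), ∑ i, (legNames (Function.update arc j L i) : Multiset ℕ) =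
      (legNames L : Multiset ℕ) + ∑ i ∈ Finset.univ.erase j, (legNames (arc i) : Multiset ℕ) := by
    intro L
    rw [← Finset.add_sum_erase _ _ (Finset.mem_univ j), Function.update_self]
    congr 1
    refine Finset.sum_congr rfl fun i hi => ?_
    rw [Function.update_of_ne (Finset.ne_of_mem_erase hi)]
  simp only [legs, key]
  abel

/-- Removing the trivalent vertex of an STU relation leaves a Jacobi diagram. -/
theorem IsJacobi.of_stu {arc : Fin n → List (Item m)} {j : Fin n} {L L' : List (Item m)}
    {h k a b : ℕ} {t : List (ℕ × ℕ × ℕ)} {e : List (Edge m)}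
    (hS : IsJacobi ⟨Function.update arc j L, (k, a, b) :: t, (h, [], k) :: e⟩)
    (hL : (legNames L' : Multiset ℕ) + {h} = (legNames L : Multiset ℕ) + {a, b}) :
    IsJacobi ⟨Function.update arc j L', t, e⟩ := by
  set S : RawDiagram m n := ⟨Function.update arc j L, (k, a, b) :: t, (h, [], k) :: e⟩ with hSdef
  set T : RawDiagram m n := ⟨Function.update arc j L', t, e⟩ with hTdef
  have hlegs : T.legs + {h} = S.legs + {a, b} := by
    have h1 := legs_update arc j L L' ((k, a, b) :: t) t ((h, [], k) :: e) e
    have : (T.legs + {h}) + (legNames L : Multiset ℕ) =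
        (S.legs + {a, b}) + (legNames L : Multiset ℕ) := by
      calc _ = (T.legs + (legNames L : Multiset ℕ)) + {h} := by abel
        _ = (S.legs + (legNames L' : Multiset ℕ)) + {h} := by rw [← h1]
        _ = S.legs + ((legNames L' : Multiset ℕ) + {h}) := by abel
        _ = S.legs + ((legNames L : Multiset ℕ) + {a, b}) := by rw [hL]
        _ = _ := by abel
    exact add_right_cancel this
  have htri : S.triHalf = {k} + {a, b} + T.triHalf := by
    simp only [triHalf, hSdef, hTdef, triNames, List.map_cons, List.sum_cons,
      Multiset.insert_eq_cons, Multiset.singleton_add]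
  have hedge : S.edgeHalf = {h} + {k} + T.edgeHalf := by
    simp [edgeHalf, hSdef, hTdef, edgeNames]
  have hmatch : T.edgeHalf = T.legs + T.triHalf := by
    have : ({h} + {k} : Multiset ℕ) + T.edgeHalf = ({h} + {k}) + (T.legs + T.triHalf) := by
      rw [← hedge, hS.matched, htri]
      calc _ = (S.legs + {a, b}) + ({k} + T.triHalf) := by abel
        _ = _ := by rw [← hlegs]; abel
    exact add_left_cancel this
  have hnodup : (({h} + {k} : Multiset ℕ) + T.edgeHalf).Nodup := by
    rw [← hedge, hS.matched]
    exact hS.nodup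
  rw [Multiset.nodup_add, Multiset.disjoint_left] at hnodup
  refine ⟨by rw [← hmatch]; exact hnodup.2.1, hmatch, ?_⟩
  intro x hx
  obtain ⟨l, hl, hc⟩ := hS.anchored x (by rw [hedge]; exact Multiset.mem_add.2 (Or.inr hx))
  have hnot : ∀ y ∈ T.edgeHalf, y ≠ h ∧ y ≠ k := by
    intro y hy
    have : y ∉ ({h} + {k} : Multiset ℕ) := fun h' => hnodup.2.2 h' hy
    simpa using this
  have habT : ∀ y, y = a ∨ y = b → y ≠ h → y ∈ T.legs := by
    intro y hy hyh
    have : y ∈ T.legs + {h} := by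
      rw [hlegs]
      exact Multiset.mem_add.2 (Or.inr (by simpa using hy))
    exact (Multiset.mem_add.1 this).resolve_right (by simpa using hyh)
  -- Follow the path in `S`. If it is about to use the removed trivalent vertex, it stands at `a` or
  -- `b`, which is univalent in `T`, and it can stop there.
  induction hc using ReflTransGen.head_induction_on with
  | refl =>
    refine ⟨l, ?_, .refl⟩
    have : l ∈ T.legs + {h} := by
      rw [hlegs]
      exact Multiset.mem_add.2 (Or.inl hl)
    exact (Multiset.mem_add.1 this).resolve_right (by simpa using (hnot l hx).1)
  | @head x y hxy _ ih =>
    rcases hxy with ⟨f, hf, hxf, hyf⟩ | ⟨f, hf, hxf, hyf⟩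
    · rcases List.mem_cons.1 hf with rfl | hf
      · simp only [edgeNames, Multiset.insert_eq_cons, Multiset.mem_cons,
          Multiset.mem_singleton] at hxf
        exact absurd hxf (not_or.2 (hnot x hx))
      · obtain ⟨l', hl', hc'⟩ := ih (mem_edgeHalf.2 ⟨f, hf, hyf⟩)
        exact ⟨l', hl', .head (Or.inl ⟨f, hf, hxf, hyf⟩) hc'⟩
    · rcases List.mem_cons.1 hf with rfl | hf
      · simp only [triNames, Multiset.insert_eq_cons, Multiset.mem_cons,
          Multiset.mem_singleton] at hxf
        exact ⟨x, habT x (hxf.resolve_left (hnot x hx).2) (hnot x hx).1, .refl⟩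
      · have hy : y ∈ T.edgeHalf := by
          rw [hmatch]
          exact Multiset.mem_add.2 (Or.inr (mem_triHalf.2 ⟨f, hf, hyf⟩))
        obtain ⟨l', hl', hc'⟩ := ih hy
        exact ⟨l', hl', .head (Or.inr ⟨f, hf, hxf, hyf⟩) hc'⟩

end RawDiagram

section

open RawDiagram

variable (K : Type*) [Field K] {m n p : ℕ}

/-- A diagram without handles and with a trivalent vertex is the first term of an STU relation. -/
theorem exists_stu (D : JacobiDiagram 0 n) (ht : D.1.tri ≠ []) :
    ∃ S T U : JacobiDiagram 0 n, cls K D = cls K S ∧ STU S.1 T.1 U.1 ∧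
      T.1.tri.length + 1 = D.1.tri.length ∧ U.1.tri.length + 1 = D.1.tri.length ∧
      T.1.edge.length + 1 = D.1.edge.length ∧ U.1.edge.length + 1 = D.1.edge.length := by
  obtain ⟨D, hD⟩ := D
  obtain ⟨h, k, hh, hk, w, he⟩ := hD.exists_leg_edge ht
  obtain rfl := word_eq_nil w
  obtain ⟨arc, tri, edge⟩ := D
  -- put the edge first
  obtain ⟨e, he1, he2⟩ : ∃ e, ∃ hD' : IsJacobi ⟨arc, tri, (h, [], k) :: e⟩,
      e.length + 1 = edge.length ∧ cls K (⟨_, hD⟩ : JacobiDiagram 0 n) =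
        cls K (⟨_, hD'⟩ : JacobiDiagram 0 n) := by
    rcases he with he | he
    · obtain ⟨s, r, rfl⟩ := List.append_of_mem he
      refine ⟨s ++ r, hD.congr rfl (.refl _) (List.perm_middle.map _), by simp; omega, ?_⟩
      exact cls_eq_of_perm K rfl (.refl _) List.perm_middle
    · obtain ⟨s, r, rfl⟩ := List.append_of_mem he
      have h1 : IsJacobi ⟨arc, tri, (k, [], h) :: (s ++ r)⟩ :=
        hD.congr rfl (.refl _) (List.perm_middle.map _)
      have h2 : IsJacobi ⟨arc, tri, (h, [], k) :: (s ++ r)⟩ :=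
        h1.congr rfl (.refl _) (.of_eq (by simp [edgeNames, ← Multiset.pair_comm k h]))
      refine ⟨s ++ r, h2, by simp; omega, ?_⟩
      have e1 : cls K (⟨_, hD⟩ : JacobiDiagram 0 n) = cls K (⟨_, h1⟩ : JacobiDiagram 0 n) :=
        cls_eq_of_perm K rfl (.refl _) List.perm_middle
      rw [e1]
      exact cls_eq_of_flip K (E := []) h1 h2
  -- put the trivalent vertex first
  obtain ⟨t, a, b, ht1, ht2⟩ : ∃ t a b, ∃ hD' : IsJacobi ⟨arc, (k, a, b) :: t, (h, [], k) :: e⟩,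
      t.length + 1 = tri.length ∧ cls K (⟨_, he1⟩ : JacobiDiagram 0 n) =
        cls K (⟨_, hD'⟩ : JacobiDiagram 0 n) := by
    obtain ⟨⟨x, y, z⟩, hxyz, hkxyz⟩ := mem_triHalf.1 hk
    obtain ⟨s, r, rfl⟩ := List.append_of_mem hxyz
    have h1 : IsJacobi ⟨arc, (x, y, z) :: (s ++ r), (h, [], k) :: e⟩ :=
      he1.congr rfl (List.perm_middle.map _) (.refl _)
    have e1 : cls K (⟨_, he1⟩ : JacobiDiagram 0 n) = cls K (⟨_, h1⟩ : JacobiDiagram 0 n) :=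
      cls_eq_of_perm K rfl List.perm_middle (.refl _)
    have hrot : ∀ x y z : ℕ, triNames (x, y, z) = triNames (y, z, x) := by
      intro x y z
      simp only [triNames, Multiset.insert_eq_cons]
      rw [Multiset.cons_swap, ← Multiset.insert_eq_cons x, Multiset.pair_comm]
      rfl
    have h2 : IsJacobi ⟨arc, (y, z, x) :: (s ++ r), (h, [], k) :: e⟩ :=
      h1.congr rfl (.of_eq (by rw [List.map_cons, List.map_cons, hrot])) (.refl _)
    have h3 : IsJacobi ⟨arc, (z, x, y) :: (s ++ r), (h, [], k) :: e⟩ :=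
      h2.congr rfl (.of_eq (by rw [List.map_cons, List.map_cons, hrot])) (.refl _)
    have e2 : cls K (⟨_, h1⟩ : JacobiDiagram 0 n) = cls K (⟨_, h2⟩ : JacobiDiagram 0 n) :=
      cls_eq_of_move K (Move.rotate _ _ _ _ _ _)
    have e3 : cls K (⟨_, h2⟩ : JacobiDiagram 0 n) = cls K (⟨_, h3⟩ : JacobiDiagram 0 n) :=
      cls_eq_of_move K (Move.rotate _ _ _ _ _ _)
    simp only [triNames, Multiset.insert_eq_cons, Multiset.mem_cons,
      Multiset.mem_singleton] at hkxyz
    rcases hkxyz with rfl | rfl | rfl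
    · exact ⟨s ++ r, y, z, h1, by simp; omega, e1⟩
    · exact ⟨s ++ r, z, x, h2, by simp; omega, e1.trans e2⟩
    · exact ⟨s ++ r, x, y, h3, by simp; omega, e1.trans (e2.trans e3)⟩
  obtain ⟨j, hj⟩ := mem_legs.1 hh
  obtain ⟨u, v, huv⟩ := List.append_of_mem (mem_legNames.1 hj)
  -- The arc is written as an update of itself to match the form of the STU relation.
  have hupd : Function.update arc j (u ++ [Item.leg h] ++ v) = arc := by
    rw [Function.update_eq_iff]
    exact ⟨by simpa using huv.symm, fun _ _ => rfl⟩
  have hS : IsJacobi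
      ⟨Function.update arc j (u ++ [Item.leg h] ++ v), (k, a, b) :: t, (h, [], k) :: e⟩ := by
    rw [hupd]
    exact ht1
  have e4 : cls K (⟨_, ht1⟩ : JacobiDiagram 0 n) = cls K (⟨_, hS⟩ : JacobiDiagram 0 n) :=
    cls_eq_of_perm K hupd.symm (.refl _) (.refl _)
  have hnames : ∀ x y, ((legNames (u ++ [Item.leg x, Item.leg y] ++ v) : List ℕ) : Multiset ℕ) +
      {h} = (legNames (u ++ [Item.leg h] ++ v) : Multiset ℕ) + {x, y} := by
    intro x y
    have h1 : legNames [(Item.leg x : Item 0), Item.leg y] = [x, y] := rfl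
    have h2 : legNames [(Item.leg h : Item 0)] = [h] := rfl
    simp only [legNames_append, h1, h2, ← Multiset.coe_add]
    have h3 : (([x, y] : List ℕ) : Multiset ℕ) = {x, y} := rfl
    rw [h3, Multiset.coe_singleton]
    abel
  have hT : IsJacobi ⟨Function.update arc j (u ++ [Item.leg a, Item.leg b] ++ v), t, e⟩ :=
    hS.of_stu (hnames a b)
  have hU : IsJacobi ⟨Function.update arc j (u ++ [Item.leg b, Item.leg a] ++ v), t, e⟩ :=
    hS.of_stu (by rw [hnames b a, Multiset.pair_comm])
  exact ⟨⟨_, hS⟩, ⟨_, hT⟩, ⟨_, hU⟩, he2.2.trans (ht2.2.trans e4), STU.intro arc j u v h k a b t e, ht2.1, ht2.1,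
    he2.1, he2.1⟩

/-- Morphisms from `0` of degree at least `k` are spanned by chord diagrams. -/
theorem degreeGE_le_of_chords {k : ℕ} {W : Submodule K (Hom K 0 n)}
    (hW : ∀ D : JacobiDiagram 0 n, D.1.tri = [] → k ≤ D.1.edge.length → cls K D ∈ W) :
    degreeGE K k 0 n ≤ W := by
  rw [degreeGE, Submodule.span_le]
  rintro _ ⟨D, hD, rfl⟩
  -- An STU relation lowers both numbers by one, so the bound passes to `T` and `U` in the induction
  -- on the number of trivalent vertices.
  have hD' : k + D.1.tri.length ≤ D.1.edge.length := by
    rw [← D.degree_add_length_tri]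
    omega
  clear hD
  change cls K D ∈ W
  induction hN : D.1.tri.length generalizing D with
  | zero => exact hW D (List.length_eq_zero_iff.1 hN) (by omega)
  | succ N ih =>
    obtain ⟨S, T, U, h1, h2, h3, h4, h5, h6⟩ := exists_stu K D (by
      intro h
      simp [h] at hN)
    rw [h1, cls_eq_of_stu K h2]
    exact Submodule.sub_mem _ (ih T (by omega) (by omega)) (ih U (by omega) (by omega))

end

namespace RawDiagram

variable {m n p : ℕ}

/-! ### Detaching chords -/

theorem map_leg_legNames (L : List (Item 0)) : (legNames L).map Item.leg = L := by
  induction L with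
  | nil => rfl
  | cons a L ih =>
    cases a with
    | leg h =>
      conv_rhs => rw [← ih]
      rfl
    | pass x => exact x.1.elim0

/-- The half-edges in a list of edges, in order. -/
def halves (E : List (Edge m)) : List ℕ := E.flatMap fun e => [e.1, e.2.2]

theorem coe_halves (E : List (Edge m)) :
    (halves E : Multiset ℕ) = (E.map edgeNames).sum := by
  rw [halves, coe_flatMap_sum]
  rfl

theorem length_halves (E : List (Edge m)) : (halves E).length = 2 * E.length := by
  rw [← Multiset.coe_card, coe_halves]
  exact card_list_sum _ _ _ fun t => by simp [edgeNames]

theorem getElem?_halves (E : List (Edge m)) (q : ℕ) (e : Edge m) (h : E[q]? = some e) :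
    (halves E)[2 * q]? = some e.1 ∧ (halves E)[2 * q + 1]? = some e.2.2 := by
  induction E generalizing q with
  | nil => simp at h
  | cons a E ih =>
    cases q with
    | zero =>
      obtain rfl : a = e := by simpa using h
      simp [halves]
    | succ q => exact ih q (by simpa using h)

/-- The diagram with `d` chords and one univalent vertex on each of `2 * d` arcs, where the chords
join consecutive arcs. -/
def chords (d : ℕ) : RawDiagram 0 (2 * d) where
  arc i := [Item.leg i.val]
  tri := []
  edge := (List.range d).map fun q => (2 * q, [], 2 * q + 1)

theorem isJacobi_chords (d : ℕ) : (chords d).IsJacobi := by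
  have h1 : (chords d).legs = Multiset.range (2 * d) := by
    have : (chords d).legs = ∑ i : Fin (2 * d), ({i.val} : Multiset ℕ) := rfl
    rw [this, ← Finset.sum_range (fun i => ({i} : Multiset ℕ)), Finset.sum_multiset_singleton]
    rfl
  have h2 : ∀ d, (chords d).edgeHalf = Multiset.range (2 * d) := by
    intro d
    induction d with
    | zero => rfl
    | succ d ih =>
      have h : Multiset.range (2 * (d + 1)) = (2 * d + 1) ::ₘ 2 * d ::ₘ Multiset.range (2 * d) := by
        rw [mul_add, mul_one, Multiset.range_succ, Multiset.range_succ]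
      rw [h, ← ih]
      simp only [edgeHalf, chords, List.range_succ, List.map_append, List.sum_append, edgeNames,
        List.map_cons, List.map_nil, List.sum_cons, List.sum_nil, Multiset.insert_eq_cons,
        ← Multiset.singleton_add]
      abel
  exact .of_tri_eq_nil rfl (by rw [h1]; exact Multiset.nodup_range _) (by rw [h1, h2])

/-- Replace the univalent vertices in the list `N` by passages through as many handles, and keep
the edges in `E` only. -/
def detach (D : RawDiagram 0 n) (N : List ℕ) {k : ℕ} (hN : N.length = k) (E : List (Edge 0)) :
    RawDiagram k n where
  arc j := (legNames (D.arc j)).map fun h =>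
    if hh : h ∈ N then Item.pass (⟨N.idxOf h, hN ▸ List.idxOf_lt_length_of_mem hh⟩, true)
    else Item.leg h
  tri := []
  edge := E.map fun e => (e.1, [], e.2.2)

section

variable {D : RawDiagram 0 n} {N : List ℕ} {k : ℕ} {hN : N.length = k} {E : List (Edge 0)}

theorem legNames_arc_detach (j : Fin n) :
    legNames ((detach D N hN E).arc j) = (legNames (D.arc j)).filter fun h => h ∉ N := by
  simp only [detach]
  induction legNames (D.arc j) with
  | nil => rfl
  | cons a L ih =>
    by_cases ha : a ∈ N
    · simp only [List.map_cons, dif_pos ha]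
      rw [List.filter_cons_of_neg (by simpa using ha), ← ih]
      rfl
    · simp only [List.map_cons, dif_neg ha]
      rw [List.filter_cons_of_pos (by simpa using ha), ← ih]
      rfl

theorem arc_detach_of_notMem {j : Fin n} {h : ℕ} (hj : legNames (D.arc j) = [h]) (hh : h ∉ N) :
    (detach D N hN E).arc j = [Item.leg h] := by
  simp only [detach, hj, List.map_singleton, dif_neg hh]

theorem arc_detach_of_mem {j : Fin n} {h : ℕ} (hj : legNames (D.arc j) = [h]) (hh : h ∈ N) :
    (detach D N hN E).arc j =
      [Item.pass (⟨N.idxOf h, hN ▸ List.idxOf_lt_length_of_mem hh⟩, true)] := by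
  simp only [detach, hj, List.map_singleton, dif_pos hh]

theorem legs_detach : (detach D N hN E).legs = D.legs.filter fun h => h ∉ N := by
  let F : Multiset ℕ →+ Multiset ℕ :=
    ⟨⟨Multiset.filter fun h => h ∉ N, Multiset.filter_zero _⟩, Multiset.filter_add _⟩
  change _ = F D.legs
  rw [legs, legs, map_sum]
  refine Finset.sum_congr rfl fun j _ => ?_
  rw [legNames_arc_detach]
  rfl

/-- Distinct positions on the arcs carry distinct half-edges, and distinct members of `N` have
distinct first positions in `N`. -/
theorem isSimple_detach (hD : D.legs.Nodup) : (detach D N hN E).IsSimple where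
  word_nil e he := by
    simp only [detach, List.mem_map] at he
    obtain ⟨_, _, rfl⟩ := he
    rfl
  pos j x hx := by
    simp only [detach, List.mem_map] at hx
    obtain ⟨h, -, hx⟩ := hx
    split_ifs at hx
    cases hx
    rfl
  once := by
    have key : ∀ (j : Fin n) (q : ℕ) (x : Letter k), ((detach D N hN E).arc j)[q]? =
        some (Item.pass x) → ∃ h ∈ N, (legNames (D.arc j))[q]? = some h ∧ x.1.val = N.idxOf h := by
      intro j q x hx
      simp only [detach, List.getElem?_map, Option.map_eq_some_iff] at hx
      obtain ⟨h, hq, hx⟩ := hx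
      split_ifs at hx with hh
      cases hx
      exact ⟨h, hh, hq, rfl⟩
    intro j j' q q' x x' hx hx' hxx
    obtain ⟨h, hh, hq, hi⟩ := key _ _ _ hx
    obtain ⟨h', hh', hq', hi'⟩ := key _ _ _ hx'
    obtain rfl : h = h' := (List.idxOf_inj hh).1 (by rw [← hi, ← hi', hxx])
    obtain rfl := arc_eq_of_mem_legNames hD (List.mem_of_getElem? hq) (List.mem_of_getElem? hq')
    exact ⟨rfl, (List.getElem?_inj (List.getElem?_eq_some_iff.1 hq).1 (nodup_legNames hD j)).1
      (hq.trans hq'.symm)⟩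

end

end RawDiagram

section

open RawDiagram

variable (K : Type*) [Field K] {n : ℕ}

/-- `RawDiagram.chords` as a morphism. -/
def JacobiDiagram.chords (d : ℕ) : JacobiDiagram 0 (2 * d) := ⟨RawDiagram.chords d, isJacobi_chords d⟩

theorem degree_chords (d : ℕ) : (JacobiDiagram.chords d).degree = d := by
  have := (JacobiDiagram.chords d).degree_add_length_tri
  simpa [JacobiDiagram.chords, RawDiagram.chords] using this

/-- Detaching `d` chords from a chord diagram gives a morphism that produces the given diagram when
applied to `chords d`. -/
theorem exists_act_chords_eq (D : JacobiDiagram 0 n) (ht : D.1.tri = []) {E E' : List (Edge 0)}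
    (hE : D.1.edge = E ++ E') {d : ℕ} (hN : (halves E).length = 2 * d) :
    ∃ hf : (detach D.1 (halves E) hN E').IsJacobi,
      act (Finsupp.single (⟨_, hf⟩ : JacobiDiagram (2 * d) n) (1 : K))
        (Finsupp.single (JacobiDiagram.chords d) 1) = cls K D ∧
      ∀ i, ∃ j x, Item.pass x ∈ (detach D.1 (halves E) hN E').arc j ∧ x.1 = i := by
  have hlegs : D.1.legs = (halves E : Multiset ℕ) + (halves E' : Multiset ℕ) := by
    rw [← D.2.edgeHalf_eq_legs ht, coe_halves, coe_halves, edgeHalf, hE, List.map_append,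
      List.sum_append]
  have hnd := D.2.nodup_legs
  have hnd' := hnd
  rw [hlegs, Multiset.nodup_add, Multiset.disjoint_left] at hnd'
  have hf : (detach D.1 (halves E) hN E').IsJacobi := by
    refine .of_tri_eq_nil rfl ?_ ?_
    · rw [legs_detach]
      exact hnd.filter _
    · have h1 : (detach D.1 (halves E) hN E').edgeHalf = (halves E' : Multiset ℕ) := by
        rw [coe_halves]
        simp only [edgeHalf, detach, List.map_map]
        rfl
      rw [h1, legs_detach, hlegs, Multiset.filter_add, Multiset.filter_eq_nil.2, zero_add,
        Multiset.filter_eq_self.2]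
      · exact fun a ha hb => hnd'.2.2 hb ha
      · exact fun a ha => by simpa using ha
  refine ⟨hf, ?_⟩
  have hmem : ∀ h ∈ halves E, ∃ j, h ∈ legNames (D.1.arc j) := fun h hh =>
    mem_legs.1 (by rw [hlegs]; exact Multiset.mem_add.2 (Or.inl hh))
  have hcov : ∀ i, ∃ j x, Item.pass x ∈ (detach D.1 (halves E) hN E').arc j ∧ x.1 = i := by
    intro i
    have hi : i.val < (halves E).length := by rw [hN]; exact i.2
    obtain ⟨j, hj⟩ := hmem _ (List.getElem_mem hi)
    refine ⟨j, (i, true), List.mem_map.2 ⟨_, hj, ?_⟩, rfl⟩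
    rw [dif_pos (List.getElem_mem hi)]
    congr 2
    exact Fin.ext (List.Nodup.idxOf_getElem (Multiset.coe_nodup.1 hnd'.1) _ hi)
  refine ⟨?_, hcov⟩
  obtain ⟨hJ, e⟩ := act_single_eq_cls K (f := ⟨_, hf⟩) (isSimple_detach (hN := hN) hnd)
    (D := JacobiDiagram.chords d) fun i _ => hcov i
  -- The names after gluing: the half-edge at position q of `halves E` is replaced by the univalent
  -- vertex q of `chords d`, which becomes `4 * q + 1`; the retained half-edges `h` become `4 * h`.
  let g : ℕ → ℕ := fun h => if h ∈ halves E then 4 * (halves E).idxOf h + 1 else 4 * h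
  have hg : Function.Injective g := by
    intro a b hab
    simp only [g] at hab
    split_ifs at hab with ha hb hb
    · exact (List.idxOf_inj ha).1 (by omega)
    · omega
    · omega
    · omega
  rw [e, ← cls_rename K D hg]
  refine cls_eq_of_perm K (funext fun j => ?_) (.of_eq ?_) ?_
  · simp only [substitute, detach, RawDiagram.rename, JacobiDiagram.chords, RawDiagram.chords]
    conv_rhs => rw [← map_leg_legNames (D.1.arc j), List.map_map]
    rw [List.flatMap_map, List.map_eq_flatMap]
    refine List.flatMap_congr fun h _ => ?_
    by_cases hh : h ∈ halves E
    · simp [hh, g, renameItem]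
    · simp [hh, g, renameItem]
  · simp [substitute, detach, RawDiagram.rename, JacobiDiagram.chords, RawDiagram.chords, ht]
  · simp only [substitute, detach, RawDiagram.rename, JacobiDiagram.chords, RawDiagram.chords, hE,
      List.map_append, List.map_map]
    -- Gluing lists the retained edges first and the chords of `chords d` after them.
    refine (List.perm_append_comm).trans (.of_eq ?_)
    have hlen : E.length = d := by
      rw [length_halves] at hN
      omega
    congr 1
    -- The ends of the q-th edge of `E` stand at the positions `2 * q` and `2 * q + 1` of `halves
    -- E`, and the q-th chord of `chords d` joins exactly these two handles' arcs.
    · refine List.ext_getElem (by simp [hlen]) fun q h1 h2 => ?_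
      have hq : q < E.length := by simpa using h2
      obtain ⟨h3, h4⟩ := getElem?_halves E q E[q] (by simp)
      obtain ⟨h5, h6⟩ := List.getElem?_eq_some_iff.1 h3
      obtain ⟨h7, h8⟩ := List.getElem?_eq_some_iff.1 h4
      have hn := Multiset.coe_nodup.1 hnd'.1
      have i1 : (halves E).idxOf E[q].1 = 2 * q := by
        rw [← h6]; exact hn.idxOf_getElem _ h5
      have i2 : (halves E).idxOf E[q].2.2 = 2 * q + 1 := by
        rw [← h8]; exact hn.idxOf_getElem _ h7
      have m1 : E[q].1 ∈ halves E := by rw [← h6]; exact List.getElem_mem h5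
      have m2 : E[q].2.2 ∈ halves E := by rw [← h8]; exact List.getElem_mem h7
      simp [renameEdge, g, i1, i2, m1, m2, word_eq_nil]
    · refine List.map_congr_left fun e he => ?_
      have m1 : e.1 ∉ halves E := fun h => hnd'.2.2 h
        (List.mem_flatMap.2 ⟨e, he, by simp⟩)
      have m2 : e.2.2 ∉ halves E := fun h => hnd'.2.2 h
        (List.mem_flatMap.2 ⟨e, he, by simp⟩)
      simp [renameEdge, g, m1, m2, word_eq_nil]

end

namespace RawDiagram

variable {m n p : ℕ}

/-! ### Perfect matchings -/

theorem sortEdge_swap (a b : ℕ) : sortEdge (a, [], b) = sortEdge (b, [], a) := by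
  unfold sortEdge
  rcases lt_trichotomy a b with h | rfl | h
  · simp [h.le, h.not_ge]
  · rfl
  · simp [h.le, h.not_ge]

theorem nodup_of_nodup_halves {E : List (Edge m)} (h : (halves E).Nodup) : E.Nodup := by
  refine (List.nodup_flatMap.1 h).2.imp ?_
  rintro e _ hd rfl
  exact hd (a := e.1) (by simp) (by simp)

theorem IsJacobi.nodup_edge_sum {D : RawDiagram m n} (hD : D.IsJacobi) :
    (D.edge.map edgeNames).sum.Nodup := by
  have := hD.nodup
  rwa [← hD.matched] at this

theorem IsJacobi.nodup_map_sortEdge {D : RawDiagram 0 n} (hD : D.IsJacobi) :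
    (D.edge.map sortEdge).Nodup := by
  refine nodup_of_nodup_halves ?_
  rw [← Multiset.coe_nodup, coe_halves, map_edgeNames_sortEdge]
  exact hD.nodup_edge_sum

/-- Each arc carries exactly one univalent vertex. -/
def IsMatching (D : RawDiagram m n) : Prop :=
  D.tri = [] ∧ ∀ i, (legNames (D.arc i)).length = 1

end RawDiagram

section

open RawDiagram

variable (K : Type*) [Field K] {n : ℕ}

theorem exists_standard_legs (D : JacobiDiagram 0 n) (hD : D.1.IsMatching) :
    ∃ D' : JacobiDiagram 0 n, cls K D' = cls K D ∧ D'.1.tri = [] ∧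
      D'.1.arc = (fun i => [Item.leg i.val]) ∧ D'.1.edge.length = D.1.edge.length ∧
      ∀ i j, D.1.ArcsJoined i j ↔ D'.1.ArcsJoined i j := by
  have hex : ∀ i, ∃ h, legNames (D.1.arc i) = [h] := fun i => List.length_eq_one_iff.1 (hD.2 i)
  choose g hg using hex
  have hinj : Function.Injective g := by
    intro i j hij
    exact arc_eq_of_mem_legNames D.2.nodup_legs (h := g i) (by simp [hg]) (by simp [hg, hij])
  classical
  -- The univalent vertex on the `i`-th arc gets the name `i`. All other numbers are moved to `n`
  -- and beyond, which keeps the renaming injective.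
  let ρ : ℕ → ℕ := fun h => if hh : ∃ i, g i = h then hh.choose.val else n + h
  have hρ : ∀ i, ρ (g i) = i := by
    intro i
    have hh : ∃ k, g k = g i := ⟨i, rfl⟩
    simp only [ρ, dif_pos hh]
    rw [hinj hh.choose_spec]
  have hρinj : Function.Injective ρ := by
    intro a b hab
    by_cases ha : ∃ i, g i = a <;> by_cases hb : ∃ i, g i = b
    · obtain ⟨i, rfl⟩ := ha
      obtain ⟨j, rfl⟩ := hb
      rw [hρ, hρ] at hab
      rw [Fin.ext hab]
    · obtain ⟨i, rfl⟩ := ha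
      rw [hρ] at hab
      simp only [ρ, dif_neg hb] at hab
      have := i.2
      omega
    · obtain ⟨i, rfl⟩ := hb
      rw [hρ] at hab
      simp only [ρ, dif_neg ha] at hab
      have := i.2
      omega
    · simp only [ρ, dif_neg ha, dif_neg hb] at hab
      omega
  refine ⟨⟨D.1.rename ρ, D.2.rename hρinj⟩, cls_rename K D hρinj, ?_, ?_, ?_, ?_⟩
  · simp [RawDiagram.rename, hD.1]
  · funext i
    simp only [RawDiagram.rename]
    rw [← map_leg_legNames (D.1.arc i), hg]
    simp [renameItem, hρ]
  · simp [RawDiagram.rename]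
  · exact ArcsJoined.rename hρinj

/-- Chord diagrams with one univalent vertex on each arc are determined by the relation of being
joined by a chord. -/
theorem cls_eq_of_joined {D D' : JacobiDiagram 0 n} (hD : D.1.IsMatching) (hD' : D'.1.IsMatching)
    (hlen : D.1.edge.length = D'.1.edge.length) (h : ∀ i j, D.1.ArcsJoined i j → D'.1.ArcsJoined i j) :
    cls K D = cls K D' := by
  obtain ⟨⟨⟨arc, t, E⟩, hA⟩, hA1, hA2, hA3, hA4, hA5⟩ := exists_standard_legs K D hD
  obtain ⟨⟨⟨arc', t', E'⟩, hB⟩, hB1, hB2, hB3, hB4, hB5⟩ := exists_standard_legs K D' hD'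
  obtain rfl : t = [] := hA2
  obtain rfl : t' = [] := hB2
  obtain rfl : arc = _ := hA3
  obtain rfl : arc' = _ := hB3
  have hsA : IsJacobi ⟨fun i : Fin n => [Item.leg i.val], [], E.map sortEdge⟩ :=
    hA.congr rfl (.refl _) (.of_eq (map_edgeNames_sortEdge E).symm)
  have hsB : IsJacobi ⟨fun i : Fin n => [Item.leg i.val], [], E'.map sortEdge⟩ :=
    hB.congr rfl (.refl _) (.of_eq (map_edgeNames_sortEdge E').symm)
  rw [← hA1, ← hB1]
  have e1 := cls_sortEdge K E [] hA hsA
  have e2 := cls_sortEdge K E' [] hB hsB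
  refine e1.trans (Eq.trans ?_ e2.symm)
  refine cls_eq_of_perm K rfl (.refl _) ?_
  -- The sorted edges are distinct and the two lists have equal length, so one inclusion suffices.
  refine (List.subperm_of_subset hA.nodup_map_sortEdge ?_).perm_of_length_le ?_
  · intro e he
    obtain ⟨⟨a, w, b⟩, hmem, rfl⟩ := List.mem_map.1 he
    obtain rfl := word_eq_nil w
    have hlt : ∀ x, x = a ∨ x = b → ∃ i : Fin n, i.val = x := by
      intro x hx
      have hx' : x ∈ (⟨fun i : Fin n => [Item.leg i.val], [], E⟩ : RawDiagram 0 n).legs := by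
        rw [← hA.edgeHalf_eq_legs rfl]
        exact mem_edgeHalf.2 ⟨_, hmem, by simpa [edgeNames] using hx⟩
      obtain ⟨i, hi⟩ := mem_legs.1 hx'
      exact ⟨i, by simpa [legNames, eq_comm] using hi⟩
    obtain ⟨i, rfl⟩ := hlt a (Or.inl rfl)
    obtain ⟨j, rfl⟩ := hlt b (Or.inr rfl)
    obtain ⟨⟨a, w, b⟩, he', hab⟩ := (hB5 i j).1 (h i j ((hA5 i j).2
      ⟨_, hmem, Or.inl ⟨by simp [legNames], by simp [legNames]⟩⟩))
    obtain rfl := word_eq_nil w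
    refine List.mem_map.2 ⟨_, he', ?_⟩
    simp only [legNames, List.filterMap_cons, List.filterMap_nil, List.mem_singleton] at hab
    rcases hab with ⟨rfl, rfl⟩ | ⟨rfl, rfl⟩
    · rfl
    · exact sortEdge_swap _ _
  · have h1 : E.length = D.1.edge.length := hA4
    have h2 : E'.length = D'.1.edge.length := hB4
    simp [h1, h2, hlen]

/-- There are 2d vertices in all, and at least 2d of them are univalent, one or more on each arc. So
none is trivalent and each arc has exactly one. -/
theorem isMatching_of_degree_eq {d : ℕ} {D : JacobiDiagram 0 (2 * d)} (hd : D.degree = d)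
    (hlegs : ∀ i, legNames (D.1.arc i) ≠ []) : D.1.IsMatching ∧ D.1.edge.length = d := by
  have h1 := D.2.two_mul_length_edge
  have h2 := D.degree_add_length_tri
  have h3 : D.1.legs.card = ∑ i, (legNames (D.1.arc i)).length := by
    rw [RawDiagram.legs, Multiset.card_sum]
    rfl
  have h4 : ∀ i ∈ (Finset.univ : Finset (Fin (2 * d))), 1 ≤ (legNames (D.1.arc i)).length :=
    fun i _ => List.length_pos_iff.2 (hlegs i)
  have h5 := Finset.sum_le_sum h4
  simp only [Finset.sum_const, Finset.card_univ, Fintype.card_fin, smul_eq_mul, mul_one] at h5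
  have h6 : D.1.tri.length = 0 := by omega
  refine ⟨⟨List.length_eq_zero_iff.1 h6, fun i => ?_⟩, by omega⟩
  refine ((Finset.sum_eq_sum_iff_of_le h4).1 ?_ i (Finset.mem_univ i)).symm
  simp only [Finset.sum_const, Finset.card_univ, Fintype.card_fin, smul_eq_mul, mul_one]
  omega

theorem isMatching_chords (d : ℕ) : (RawDiagram.chords d).IsMatching := ⟨rfl, fun _ => rfl⟩

/-! ### Adding a chord -/

/-- A morphism that adds the chord number `j` to `chords d`. -/
theorem exists_add_chord (d j : ℕ) (hj : j < d + 1) :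
    ∃ f : JacobiDiagram (2 * d) (2 * (d + 1)), f.1.IsSimple ∧
      (∀ i, ∃ k x, Item.pass x ∈ f.1.arc k ∧ x.1 = i) ∧
      f.1.tri = [] ∧ f.1.edge = [(2 * j, [], 2 * j + 1)] ∧
      (∀ i : Fin (2 * (d + 1)), i.val = 2 * j ∨ i.val = 2 * j + 1 → f.1.arc i = [Item.leg i.val]) ∧
      (j = d → ∀ (i : Fin (2 * (d + 1))) (hi : i.val < 2 * d),
        f.1.arc i = [Item.pass (⟨i.val, hi⟩, true)]) ∧
      act (Finsupp.single f (1 : K)) (Finsupp.single (JacobiDiagram.chords d) 1) =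
        cls K (JacobiDiagram.chords (d + 1)) := by
  let c : ℕ → Edge 0 := fun q => (2 * q, [], 2 * q + 1)
  -- The chords of `chords (d + 1)` other than the `j`-th. These are detached, so that the resulting
  -- morphism itself carries the `j`-th chord.
  let E := ((List.range (d + 1)).erase j).map c
  have hjm : j ∈ List.range (d + 1) := List.mem_range.2 hj
  have hperm : ((List.range (d + 1)).map c).Perm (E ++ [c j]) :=
    ((List.perm_cons_erase hjm).map c).trans (List.perm_append_singleton _ _).symm
  have hJ : IsJacobi ⟨(RawDiagram.chords (d + 1)).arc, [], E ++ [c j]⟩ :=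
    (isJacobi_chords (d + 1)).congr rfl (.refl _) (hperm.map _)
  have hN : (halves E).length = 2 * d := by
    rw [length_halves]
    simp [E, List.length_erase_of_mem hjm]
  have hmem : ∀ q, 2 * q ∈ halves E ∨ 2 * q + 1 ∈ halves E → q ∈ (List.range (d + 1)).erase j := by
    intro q hq
    simp only [halves, E, List.mem_flatMap, List.mem_map] at hq
    rcases hq with ⟨_, ⟨r, hr, rfl⟩, h⟩ | ⟨_, ⟨r, hr, rfl⟩, h⟩
    · simp only [c, List.mem_cons, List.not_mem_nil, or_false] at h
      obtain rfl : q = r := by omega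
      exact hr
    · simp only [c, List.mem_cons, List.not_mem_nil, or_false] at h
      obtain rfl : q = r := by omega
      exact hr
  have hjn : j ∉ (List.range (d + 1)).erase j := fun h =>
    (List.Nodup.mem_erase_iff List.nodup_range).1 h |>.1 rfl
  obtain ⟨hf, hact, hcov⟩ := exists_act_chords_eq K (⟨_, hJ⟩ : JacobiDiagram 0 (2 * (d + 1))) rfl
    (E := E) (E' := [c j]) rfl hN
  refine ⟨⟨_, hf⟩, isSimple_detach (hN := hN) hJ.nodup_legs, hcov, rfl, rfl, ?_, ?_, ?_⟩
  · intro i hi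
    have hi' : i.val ∉ halves E := by
      intro h
      refine hjn (hmem j ?_)
      rcases hi with hi | hi <;> rw [hi] at h
      · exact Or.inl h
      · exact Or.inr h
    exact arc_detach_of_notMem (hN := hN) rfl hi'
  -- For the last chord, the detached half-edges are 0, ..., 2d - 1 in their natural order, so the
  -- `i`-th arc passes the `i`-th handle.
  · rintro rfl i hi
    have hE : halves E = List.range (2 * j) := by
      have h1 : (List.range (j + 1)).erase j = List.range j := by
        rw [List.range_succ, List.erase_append_right _ (by simp)]
        simp
      have h2 : ∀ j, halves ((List.range j).map c) = List.range (2 * j) := by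
        intro j
        induction j with
        | zero => rfl
        | succ j ih =>
          rw [List.range_succ, List.map_append, halves, List.flatMap_append, ← halves, ih, mul_add,
            mul_one, List.range_succ, List.range_succ]
          simp [c]
      simp only [E]
      rw [h1, h2]
    have hi' : i.val ∈ halves E := by
      rw [hE]
      exact List.mem_range.2 hi
    refine (arc_detach_of_mem (hN := hN) rfl hi').trans ?_
    congr 3
    refine Fin.ext ?_
    simp only [hE]
    have := List.Nodup.idxOf_getElem (List.nodup_range (n := 2 * j)) i.val (by simpa using hi)
    rwa [List.getElem_range] at this
  · rw [hact]
    exact cls_eq_of_perm K rfl (.refl _) hperm.symm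

end

/-! ### The component of the generator in lowest degree -/

section

open RawDiagram

variable {K : Type*} [Field K] {m n p : ℕ}

/-- Both sides are linear in `ξ`, so it is enough to compare them on single diagrams. -/
theorem act_single_right_ext {φ : Chains K n p} {V : Type*} [AddCommGroup V] [Module K V]
    {F : Hom K m p →ₗ[K] V} {G : Chains K m n →ₗ[K] V}
    (h : ∀ D, F (act φ (Finsupp.single D 1)) = G (Finsupp.single D 1)) (ξ : Chains K m n) :
    F (act φ ξ) = G ξ := by
  have : F ∘ₗ act φ = G := by
    refine Finsupp.lhom_ext' fun D => LinearMap.ext_ring ?_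
    exact h D
  exact LinearMap.congr_fun this ξ

/-- If adding any of the chords to `ξ` gives the same result, then only the matching of `chords d`
occurs in degree `d` in `ξ`. -/
theorem chordForm_eq_zero_of_add_chord {d : ℕ} {ξ : Chains K 0 (2 * d)}
    (hξ : ∀ f g : JacobiDiagram (2 * d) (2 * (d + 1)), f.degree = 1 → g.degree = 1 →
      act (Finsupp.single f (1 : K)) (Finsupp.single (JacobiDiagram.chords d) 1) =
        act (Finsupp.single g (1 : K)) (Finsupp.single (JacobiDiagram.chords d) 1) →
      act (Finsupp.single f (1 : K)) ξ - act (Finsupp.single g (1 : K)) ξ ∈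
        degreeGE K (d + 2) 0 (2 * (d + 1)))
    {μ : Fin (2 * d) → Fin (2 * d) → Prop} {i i' : Fin (2 * d)} {j : ℕ} (hi : i.val = 2 * j)
    (hi' : i'.val = 2 * j + 1) (hμ : ¬ μ i i') :
    chordForm K 0 d (fun B => ∀ i i', B i i' ↔ μ i i') ((relations K 0 (2 * d)).mkQ ξ) = 0 := by
  have hjd : j < d := by have := i'.2; omega
  have hdeg : ∀ {q : ℕ} (f : JacobiDiagram (2 * d) (2 * (d + 1))), f.1.tri = [] →
      f.1.edge = [(2 * q, [], 2 * q + 1)] → f.degree = 1 := by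
    intro q f h1 h2
    have := f.degree_add_length_tri
    rw [h1, h2] at this
    simpa using this
  obtain ⟨f, hfs, hfc, hft, hfe, hfl, -, hfa⟩ := exists_add_chord K d j (by omega)
  obtain ⟨g, hgs, hgc, hgt, hge, -, hgp, hga⟩ := exists_add_chord K d d (by omega)
  let ι : Fin (2 * d) → Fin (2 * (d + 1)) := Fin.castLE (by omega)
  -- Only the first 2d arcs are tested. The chord of `f` lies on two of them, whereas the chord of
  -- `g` lies on the last two arcs and is not seen.
  let P : (Fin (2 * (d + 1)) → Fin (2 * (d + 1)) → Prop) → Prop :=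
    fun B => ∀ i i', B (ι i) (ι i') ↔ μ i i'
  have h0 := chordForm_eq_zero (K := K) (k := d + 1) (by omega) (P := P)
    (hξ f g (hdeg f hft hfe) (hdeg g hgt hge) (hfa.trans hga.symm))
  rw [map_sub] at h0
  -- Every diagram of `f ∘ ξ` joins the arcs 2j and 2j + 1, which `μ` does not.
  have hf0 : chordForm K 0 (d + 1) P (act (Finsupp.single f (1 : K)) ξ) = 0 := by
    refine act_single_right_ext (G := 0) (fun D => ?_) ξ
    obtain ⟨hJ, e⟩ := act_single_eq_cls K hfs (D := D) fun i _ => hfc i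
    refine ((congrArg _ e).trans (chordForm_cls _ _ _)).trans ?_
    refine if_neg ?_
    rintro ⟨-, -, hP⟩
    refine hμ ((hP i i').1 ⟨(4 * (2 * j), [], 4 * (2 * j + 1)), ?_, Or.inl ⟨?_, ?_⟩⟩)
    · simp [substitute, hfe]
    · have := hfl (ι i) (Or.inl hi)
      have hv : (ι i).val = 2 * j := hi
      simp [substitute, this, hv, legNames]
    · have := hfl (ι i') (Or.inr hi')
      have hv : (ι i').val = 2 * j + 1 := hi'
      simp [substitute, this, hv, legNames]
  -- On the first 2d arcs `g ∘ D` looks like `D`, and it has one chord more.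
  have hg0 : chordForm K 0 (d + 1) P (act (Finsupp.single g (1 : K)) ξ) =
      chordForm K 0 d (fun B => ∀ i i', B i i' ↔ μ i i') ((relations K 0 (2 * d)).mkQ ξ) := by
    refine act_single_right_ext (G := chordForm K 0 d (fun B => ∀ i i', B i i' ↔ μ i i') ∘ₗ
      (relations K 0 (2 * d)).mkQ) (fun D => ?_) ξ
    obtain ⟨hJ, e⟩ := act_single_eq_cls K hgs (D := D) fun i _ => hgc i
    refine ((congrArg _ e).trans (chordForm_cls _ _ _)).trans
      (Eq.trans ?_ (chordForm_cls d _ D).symm)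
    have harc : ∀ i, (substitute g.1 D.1).arc (ι i) =
        (D.1.arc i).map (renameItem fun h => 4 * h + 1) := by
      intro i
      simp only [substitute, hgp rfl (ι i) i.2, List.flatMap_singleton]
      rfl
    have hjoin : ∀ i i', (substitute g.1 D.1).ArcsJoined (ι i) (ι i') ↔ D.1.ArcsJoined i i' := by
      intro i i'
      simp only [ArcsJoined, harc, mem_legNames_rename]
      simp only [substitute, hge, List.map_cons, List.map_nil, List.mem_append, List.mem_map,
        List.mem_singleton]
      constructor
      -- The chord of `g` has names divisible by 4, while the univalent vertices on these arcs have
      -- names congruent to 1 modulo 4; so it has no end here.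
      · rintro ⟨e, rfl | ⟨e, he, rfl⟩, ⟨⟨a, ha, ha'⟩, b, hb, hb'⟩ | ⟨⟨a, ha, ha'⟩, b, hb, hb'⟩⟩
        · simp only at ha'
          omega
        · simp only at ha'
          omega
        · simp only [renameEdge, add_left_inj, mul_eq_mul_left_iff, OfNat.ofNat_ne_zero,
            or_false] at ha' hb'
          subst ha' hb'
          exact ⟨e, he, Or.inl ⟨ha, hb⟩⟩
        · simp only [renameEdge, add_left_inj, mul_eq_mul_left_iff, OfNat.ofNat_ne_zero,
            or_false] at ha' hb'
          subst ha' hb'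
          exact ⟨e, he, Or.inr ⟨ha, hb⟩⟩
      · rintro ⟨e, he, ⟨ha, hb⟩ | ⟨ha, hb⟩⟩
        · exact ⟨_, Or.inr ⟨e, he, rfl⟩, Or.inl ⟨⟨_, ha, rfl⟩, _, hb, rfl⟩⟩
        · exact ⟨_, Or.inr ⟨e, he, rfl⟩, Or.inr ⟨⟨_, ha, rfl⟩, _, hb, rfl⟩⟩
    refine chordIndicator_congr K ?_ ?_ ?_
    · simp [substitute, hgt]
    · simp only [substitute, hge, List.length_append, List.length_map, List.length_singleton]
      omega
    · simp only [P, hjoin]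
  rw [hf0, zero_sub, neg_eq_zero, hg0] at h0
  exact h0

theorem joined_chords {d : ℕ} {i i' : Fin (2 * d)} (h : (RawDiagram.chords d).ArcsJoined i i') :
    ∃ j, (i.val = 2 * j ∧ i'.val = 2 * j + 1) ∨ (i.val = 2 * j + 1 ∧ i'.val = 2 * j) := by
  obtain ⟨e, he, h⟩ := h
  obtain ⟨j, -, rfl⟩ := List.mem_map.1 he
  simp only [RawDiagram.chords, legNames, List.filterMap_cons, List.filterMap_nil,
    List.mem_singleton] at h
  exact ⟨j, by omega⟩

theorem RawDiagram.ArcsJoined.symm {D : RawDiagram m n} {i j : Fin n} (h : D.ArcsJoined i j) : D.ArcsJoined j i := by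
  obtain ⟨e, he, ⟨h1, h2⟩ | ⟨h1, h2⟩⟩ := h
  · exact ⟨e, he, Or.inr ⟨h2, h1⟩⟩
  · exact ⟨e, he, Or.inl ⟨h2, h1⟩⟩

/-- The degree `d` diagrams in `ξ` are perfect matchings of the arcs, and diagrams with the same
matching have the same class. The total coefficient of a matching is a value of `chordForm`, which
vanishes unless the matching joins 2j to 2j + 1 for all j. -/
theorem mkQ_mem_of_add_chord {d : ℕ} {ξ : Chains K 0 (2 * d)} (hd : ξ ∈ chainsGE K d 0 (2 * d))
    (hlegs : ∀ D ∈ ξ.support, ∀ i, legNames (D.1.arc i) ≠ [])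
    (hξ : ∀ f g : JacobiDiagram (2 * d) (2 * (d + 1)), f.degree = 1 → g.degree = 1 →
      act (Finsupp.single f (1 : K)) (Finsupp.single (JacobiDiagram.chords d) 1) =
        act (Finsupp.single g (1 : K)) (Finsupp.single (JacobiDiagram.chords d) 1) →
      act (Finsupp.single f (1 : K)) ξ - act (Finsupp.single g (1 : K)) ξ ∈
        degreeGE K (d + 2) 0 (2 * (d + 1))) :
    (relations K 0 (2 * d)).mkQ ξ ∈
      Submodule.span K {cls K (JacobiDiagram.chords d)} ⊔ degreeGE K (d + 1) 0 (2 * d) := by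
  classical
  set W := Submodule.span K {cls K (JacobiDiagram.chords d)} ⊔ degreeGE K (d + 1) 0 (2 * d)
  let S := ξ.support.filter fun D => D.degree = d
  have hS : ∀ D ∈ S, D.1.IsMatching ∧ D.1.edge.length = d := fun D hD =>
    isMatching_of_degree_eq (Finset.mem_filter.1 hD).2 (hlegs D (Finset.mem_filter.1 hD).1)
  have hsum : (relations K 0 (2 * d)).mkQ ξ = ∑ D ∈ ξ.support, ξ D • cls K D := by
    conv_lhs => rw [← Finsupp.sum_single ξ]
    rw [Finsupp.sum, map_sum]
    refine Finset.sum_congr rfl fun D _ => ?_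
    rw [cls, ← map_smul, Finsupp.smul_single, smul_eq_mul, mul_one]
  rw [hsum, ← Finset.sum_filter_add_sum_filter_not _ fun D => D.degree = d]
  refine Submodule.add_mem _ ?_ (Submodule.sum_mem _ fun D hD => Submodule.smul_mem _ _ ?_)
  swap
  · have h1 := (Finsupp.mem_supported K ξ).1 hd (Finset.mem_filter.1 hD).1
    have h2 := (Finset.mem_filter.1 hD).2
    refine Submodule.mem_sup_right (cls_mem_degreeGE ?_)
    have h1' : d ≤ D.degree := h1
    omega
  change ∑ D ∈ S, ξ D • cls K D ∈ W
  -- Group the diagrams of degree `d` by their matching.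
  rw [← Finset.sum_fiberwise_of_maps_to (t := S.image fun D => D.1.ArcsJoined)
    (g := fun D => D.1.ArcsJoined) fun D hD => Finset.mem_image_of_mem _ hD]
  refine Submodule.sum_mem _ fun μ hμ => ?_
  obtain ⟨D₀, hD₀, rfl⟩ := Finset.mem_image.1 hμ
  have hcoef : ∑ D ∈ S with D.1.ArcsJoined = D₀.1.ArcsJoined, ξ D • cls K D =
      (∑ D ∈ S with D.1.ArcsJoined = D₀.1.ArcsJoined, ξ D) • cls K D₀ := by
    rw [Finset.sum_smul]
    refine Finset.sum_congr rfl fun D hD => ?_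
    obtain ⟨h1, h2⟩ := Finset.mem_filter.1 hD
    rw [cls_eq_of_joined K (hS D h1).1 (hS D₀ hD₀).1 ((hS D h1).2.trans (hS D₀ hD₀).2.symm)
      fun i j h => h2 ▸ h]
  rw [hcoef]
  by_cases hstd : ∀ (i i' : Fin (2 * d)) (j : ℕ), i.val = 2 * j → i'.val = 2 * j + 1 →
      D₀.1.ArcsJoined i i'
  · refine Submodule.smul_mem _ _ (Submodule.mem_sup_left (Submodule.mem_span_singleton.2 ⟨1, ?_⟩))
    rw [one_smul]
    refine cls_eq_of_joined K (isMatching_chords d) (hS D₀ hD₀).1 ?_ fun i i' h => ?_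
    · rw [(hS D₀ hD₀).2]
      simp [JacobiDiagram.chords, RawDiagram.chords]
    · obtain ⟨j, ⟨h1, h2⟩ | ⟨h1, h2⟩⟩ := joined_chords h
      · exact hstd i i' j h1 h2
      · exact ArcsJoined.symm (hstd i' i j h2 h1)
  · push Not at hstd
    obtain ⟨i, i', j, hi, hi', hno⟩ := hstd
    have h0 := chordForm_eq_zero_of_add_chord hξ (μ := D₀.1.ArcsJoined) hi hi' hno
    rw [chordForm_mkQ] at h0
    -- The indicator adds no further condition: a diagram of degree `d` in `ξ` has no trivalent
    -- vertex and exactly `d` chords.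
    have : ∑ D ∈ S with D.1.ArcsJoined = D₀.1.ArcsJoined, ξ D = 0 := by
      rw [← h0, Finset.filter_filter, Finset.sum_filter, Finsupp.sum]
      refine Finset.sum_congr rfl fun D hD => ?_
      by_cases h1 : D.degree = d
      · have h2 := isMatching_of_degree_eq h1 (hlegs D hD)
        by_cases h3 : D.1.ArcsJoined = D₀.1.ArcsJoined
        · rw [if_pos ⟨h1, h3⟩, chordIndicator, if_pos ⟨h2.1.1, h2.2, fun i i' => by rw [h3]⟩,
            mul_one]
        · rw [if_neg fun h => h3 h.2, chordIndicator, if_neg, mul_zero]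
          rintro ⟨-, -, h⟩
          exact h3 (funext fun i => funext fun i' => propext (h i i'))
      · rw [if_neg fun h => h1 h.1, chordIndicator_eq_zero h1, mul_zero]
    rw [this, zero_smul]
    exact Submodule.zero_mem _

end

section

open RawDiagram

variable {K : Type*} [Field K] {m n p : ℕ}

/-! ### Splittings -/

/-- `F` and `G` are submodules of the part of degree at least `d` of the module represented by `0`
that induce a decomposition modulo the part of degree at least `d'`. -/
structure IsSplitting (d d' : ℕ) (F G : ∀ n, Submodule K (Hom K 0 n)) : Prop where
  act_left : ∀ {m n : ℕ} (φ : Chains K m n) {ξ : Chains K 0 m}, ξ ∈ chainsGE K d 0 m →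
    (relations K 0 m).mkQ ξ ∈ F m → act φ ξ ∈ F n
  act_right : ∀ {m n : ℕ} (φ : Chains K m n) {ξ : Chains K 0 m}, ξ ∈ chainsGE K d 0 m →
    (relations K 0 m).mkQ ξ ∈ G m → act φ ξ ∈ G n
  sup : ∀ n, F n ⊔ G n = degreeGE K d 0 n
  inf : ∀ n, F n ⊓ G n = degreeGE K d' 0 n

theorem linearMap_eq_of_support {V : Type*} [AddCommGroup V] [Module K V]
    {L L' : Chains K m n →ₗ[K] V} {ξ : Chains K m n}
    (h : ∀ D ∈ ξ.support, L (Finsupp.single D 1) = L' (Finsupp.single D 1)) : L ξ = L' ξ := by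
  rw [← Finsupp.sum_single ξ, Finsupp.sum, map_sum, map_sum]
  refine Finset.sum_congr rfl fun D hD => ?_
  rw [← mul_one (ξ D), ← smul_eq_mul, ← Finsupp.smul_single, map_smul, map_smul, h D hD]

namespace IsSplitting

variable {d d' : ℕ} {F G : ∀ n, Submodule K (Hom K 0 n)}

theorem symm (h : IsSplitting d d' F G) : IsSplitting d d' G F :=
  ⟨h.act_right, h.act_left, fun n => by rw [sup_comm, h.sup], fun n => by rw [inf_comm, h.inf]⟩

theorem le_left (h : IsSplitting d d' F G) : degreeGE K d' 0 n ≤ F n := by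
  rw [← h.inf]
  exact inf_le_left

theorem le_right (h : IsSplitting d d' F G) : degreeGE K d' 0 n ≤ G n := by
  rw [← h.inf]
  exact inf_le_right

/-- What annihilates a chain annihilates its component in `F`. -/
theorem act_mem (h : IsSplitting d d' F G) {c ξ : Chains K 0 m} (hc : c ∈ chainsGE K d 0 m)
    (hξ : ξ ∈ chainsGE K d 0 m) (hF : (relations K 0 m).mkQ ξ ∈ F m)
    (hG : (relations K 0 m).mkQ (c - ξ) ∈ G m) {φ : Chains K m n}
    (hφ : act φ c ∈ degreeGE K d' 0 n) : act φ ξ ∈ degreeGE K d' 0 n := by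
  rw [← h.inf]
  refine ⟨h.act_left φ hξ hF, ?_⟩
  -- The value on `ξ` is the value on `c` minus the value on `c - ξ`, so it lies in `G` as well.
  have h1 := h.act_right φ (Submodule.sub_mem _ hc hξ) hG
  rw [map_sub] at h1
  have := Submodule.sub_mem _ (h.le_right hφ) h1
  rwa [sub_sub_cancel] at this

/-- The component of `chords d` in `F` is represented by diagrams with univalent vertices on all
arcs. -/
theorem exists_component (h : IsSplitting d d' F G) :
    ∃ ξ ∈ chainsGE K d 0 (2 * d), (relations K 0 (2 * d)).mkQ ξ ∈ F (2 * d) ∧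
      (relations K 0 (2 * d)).mkQ (Finsupp.single (JacobiDiagram.chords d) 1 - ξ) ∈ G (2 * d) ∧
      ∀ D ∈ ξ.support, ∀ i, legNames (D.1.arc i) ≠ [] := by
  classical
  set c : Chains K 0 (2 * d) := Finsupp.single (JacobiDiagram.chords d) 1 with hc
  have hcd : c ∈ chainsGE K d 0 (2 * d) := single_mem_chainsGE (degree_chords d).ge 1
  suffices hS : ∀ S : Finset (Fin (2 * d)), ∃ ξ ∈ chainsGE K d 0 (2 * d),
      (relations K 0 (2 * d)).mkQ ξ ∈ F (2 * d) ∧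
      (relations K 0 (2 * d)).mkQ (c - ξ) ∈ G (2 * d) ∧
      ∀ D ∈ ξ.support, ∀ i ∈ S, legNames (D.1.arc i) ≠ [] by
    obtain ⟨ξ, h1, h2, h3, h4⟩ := hS Finset.univ
    exact ⟨ξ, h1, h2, h3, fun D hD i => h4 D hD i (Finset.mem_univ i)⟩
  intro S
  induction S using Finset.induction_on with
  | empty =>
    have h1 := mkQ_mem_degreeGE hcd
    rw [← h.sup, Submodule.mem_sup] at h1
    obtain ⟨x, hx, y, hy, hxy⟩ := h1
    have hx' : x ∈ degreeGE K d 0 (2 * d) := by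
      rw [← h.sup]
      exact Submodule.mem_sup_left hx
    obtain ⟨ξ, hξ, rfl⟩ := exists_chain_of_mem_degreeGE hx'
    refine ⟨ξ, hξ, hx, ?_, by simp⟩
    rw [map_sub, ← hxy, add_sub_cancel_left]
    exact hy
  | insert i S hi ih =>
    obtain ⟨ξ, h1, h2, h3, h4⟩ := ih
    let φ : Chains K (2 * d) (2 * d) := Finsupp.single (JacobiDiagram.omitArc i) 1
    have hφc : act φ c = 0 := act_omitArc_of_ne_nil K i (List.cons_ne_nil _ _)
    have h5 : act φ ξ ∈ degreeGE K d' 0 (2 * d) :=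
      h.act_mem hcd h1 h2 h3 (by rw [hφc]; exact Submodule.zero_mem _)
    -- Omitting the `i`-th arc annihilates `ξa` and fixes the class of `ξb`. Since it annihilates
    -- `chords d`, the class of `ξb` has degree at least `d'` and `ξb` can be dropped.
    let ξa := ξ.filter fun D => legNames (D.1.arc i) ≠ []
    let ξb := ξ.filter fun D => ¬ legNames (D.1.arc i) ≠ []
    have hab : ξa + ξb = ξ := Finsupp.filter_add_filter_not ξ _
    have ha : act φ ξa = 0 := by
      refine linearMap_eq_of_support (L := act φ) (L' := 0) fun D hD => ?_
      rw [Finsupp.support_filter, Finset.mem_filter] at hD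
      exact act_omitArc_of_ne_nil K i hD.2
    have hb : act φ ξb = (relations K 0 (2 * d)).mkQ ξb := by
      refine linearMap_eq_of_support fun D hD => ?_
      rw [Finsupp.support_filter, Finset.mem_filter] at hD
      exact act_omitArc_of_eq_nil K i (not_not.1 hD.2)
    rw [← hab, map_add, ha, zero_add, hb] at h5
    have hξa : ξa = ξ - ξb := by rw [← hab, add_sub_cancel_right]
    refine ⟨ξa, ?_, ?_, ?_, ?_⟩
    · rw [chainsGE, Finsupp.mem_supported] at h1 ⊢
      refine subset_trans ?_ h1
      rw [Finsupp.support_filter]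
      exact Finset.coe_subset.2 (Finset.filter_subset _ _)
    · rw [hξa, map_sub]
      exact Submodule.sub_mem _ h2 (h.le_left h5)
    · rw [hξa, ← sub_add, map_add]
      exact Submodule.add_mem _ h3 (h.le_right h5)
    · intro D hD k hk
      rw [Finsupp.support_filter, Finset.mem_filter] at hD
      rcases Finset.mem_insert.1 hk with rfl | hk
      · exact hD.2
      · exact h4 D hD.1 k hk

/-- If `F` contains `chords d` up to higher degree, then it contains everything. -/
theorem le_of_chords_mem (h : IsSplitting d d' F G) (hd : d ≤ d')
    (hc : cls K (JacobiDiagram.chords d) ∈ F (2 * d) ⊔ degreeGE K (d + 1) 0 (2 * d)) (n : ℕ) :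
    degreeGE K d 0 n ≤ F n := by
  obtain ⟨x, hx, z, hz, hxz⟩ := Submodule.mem_sup.1 hc
  obtain ⟨ζ, hζ, rfl⟩ := exists_chain_of_mem_degreeGE hz
  let c : Chains K 0 (2 * d) := Finsupp.single (JacobiDiagram.chords d) 1
  have hcd : c ∈ chainsGE K d 0 (2 * d) := single_mem_chainsGE (degree_chords d).ge 1
  have hcζ : c - ζ ∈ chainsGE K d 0 (2 * d) :=
    Submodule.sub_mem _ hcd (chainsGE_anti (Nat.le_succ d) hζ)
  have hF : (relations K 0 (2 * d)).mkQ (c - ζ) ∈ F (2 * d) := by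
    have : (relations K 0 (2 * d)).mkQ (c - ζ) = x := by
      rw [map_sub, sub_eq_iff_eq_add, hxz]
      rfl
    rwa [this]
  -- Detach the first `d` chords: the diagram is f ∘ c = f ∘ (c - ζ) + f ∘ ζ with f of degree at
  -- least j - d. The first term lies in `F`, and the second has degree at least (j - d) + (d + 1) =
  -- j + 1.
  have step : ∀ j, d ≤ j → degreeGE K j 0 n ≤ F n ⊔ degreeGE K (j + 1) 0 n := by
    intro j hj
    refine degreeGE_le_of_chords K fun D ht hjD => ?_
    have hN : (halves (D.1.edge.take d)).length = 2 * d := by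
      rw [length_halves, List.length_take, min_eq_left (hj.trans hjD)]
    obtain ⟨hf, e, -⟩ := exists_act_chords_eq K D ht (List.take_append_drop d D.1.edge).symm hN
    have hdeg : j - d ≤ JacobiDiagram.degree ⟨_, hf⟩ := by
      have := JacobiDiagram.degree_add_length_tri ⟨_, hf⟩
      change JacobiDiagram.degree ⟨_, hf⟩ + 0 = (List.map _ (List.drop d D.1.edge)).length at this
      rw [List.length_map, List.length_drop] at this
      omega
    rw [← e, ← sub_add_cancel (Finsupp.single (JacobiDiagram.chords d) (1 : K)) ζ, map_add]
    refine Submodule.add_mem_sup (h.act_left _ hcζ hF) ?_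
    refine degreeGE_anti ?_ (act_mem_degreeGE (single_mem_chainsGE hdeg 1) hζ)
    omega
  have all : ∀ k, degreeGE K d 0 n ≤ F n ⊔ degreeGE K (d + k) 0 n := by
    intro k
    induction k with
    | zero => exact le_sup_right
    | succ k ih =>
      refine ih.trans (sup_le le_sup_left ?_)
      exact step (d + k) (Nat.le_add_right _ _)
  -- After d' - d steps the error lies in degree at least `d'`, which is contained in `F`.
  refine (all (d' - d)).trans (sup_le le_rfl ?_)
  rw [Nat.add_sub_cancel' hd]
  exact h.le_left

/-- One of the two parts of a splitting contains everything. -/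
theorem le_or_le (h : IsSplitting d d' F G) (hd : d + 2 ≤ d') :
    (∀ n, degreeGE K d 0 n ≤ F n) ∨ ∀ n, degreeGE K d 0 n ≤ G n := by
  obtain ⟨ξ, h1, h2, h3, h4⟩ := h.exists_component
  have hcd : (Finsupp.single (JacobiDiagram.chords d) 1 : Chains K 0 (2 * d)) ∈
    chainsGE K d 0 (2 * d) := single_mem_chainsGE (degree_chords d).ge 1
  -- If `f` and `g` agree on `chords d`, their difference annihilates it and hence annihilates `ξ`
  -- modulo degree `d'`, all the more modulo degree d + 2.
  have h5 := mkQ_mem_of_add_chord h1 h4 fun f g _ _ hfg => by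
    rw [← act_sub_left]
    refine degreeGE_anti hd (h.act_mem hcd h1 h2 h3 ?_)
    rw [act_sub_left, hfg, sub_self]
    exact Submodule.zero_mem _
  obtain ⟨y, hy, z, hz, hyz⟩ := Submodule.mem_sup.1 h5
  obtain ⟨a, rfl⟩ := Submodule.mem_span_singleton.1 hy
  rw [map_sub] at h3
  -- Here ξ = a c + z with `z` of degree at least d + 1. For a = 0, c agrees up to `z` with c - ξ,
  -- which is in `G`; otherwise it agrees up to higher degree with a⁻¹ ξ, which is in `F`.
  by_cases ha : a = 0
  · right
    refine h.symm.le_of_chords_mem (by omega) ?_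
    have : cls K (JacobiDiagram.chords d) =
        (cls K (JacobiDiagram.chords d) - (relations K 0 (2 * d)).mkQ ξ) + z := by
      rw [← hyz, ha, zero_smul, zero_add, sub_add_cancel]
    rw [this]
    exact Submodule.add_mem_sup h3 hz
  · left
    refine h.le_of_chords_mem (by omega) ?_
    have : cls K (JacobiDiagram.chords d) =
        a⁻¹ • (relations K 0 (2 * d)).mkQ ξ + -(a⁻¹ • z) := by
      rw [← hyz, smul_add, smul_smul, inv_mul_cancel₀ ha, one_smul, add_neg_cancel_right]
    rw [this]
    exact Submodule.add_mem_sup (Submodule.smul_mem _ _ h2)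
      (Submodule.neg_mem _ (Submodule.smul_mem _ _ hz))

end IsSplitting

/-! ### From the subquotient to splittings -/

/-- The preimage in the space of morphisms of a subspace of the subquotient. -/
noncomputable def preimage {d d' : ℕ} (W : ∀ n, Submodule K (Subquotient K d d' n)) (n : ℕ) :
    Submodule K (Hom K 0 n) :=
  ((W n).comap (Submodule.mkQ _)).map (degreeGE K d 0 n).subtype

variable {d d' : ℕ}

theorem mem_preimage {W : ∀ n, Submodule K (Subquotient K d d' n)} {x : Hom K 0 n} :
    x ∈ preimage W n ↔ ∃ hx : x ∈ degreeGE K d 0 n,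
      (Submodule.Quotient.mk ⟨x, hx⟩ : Subquotient K d d' n) ∈ W n := by
  simp only [preimage, Submodule.mem_map, Submodule.mem_comap, Submodule.mkQ_apply]
  constructor
  · rintro ⟨y, hy, rfl⟩
    exact ⟨y.2, hy⟩
  · rintro ⟨hx, hy⟩
    exact ⟨⟨x, hx⟩, hy, rfl⟩

theorem mk_eq_zero_iff {x : degreeGE K d 0 n} :
    (Submodule.Quotient.mk x : Subquotient K d d' n) = 0 ↔ x.1 ∈ degreeGE K d' 0 n := by
  rw [Submodule.Quotient.mk_eq_zero]
  rfl

/-- Stacking does not lower the degree, so the result is again an element of the module, and `φ` and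
`ξ` are the representatives that `IsComposition` asks for. -/
theorem act_mem_preimage {W : ∀ n, Submodule K (Subquotient K d d' n)} (hW : IsStable W)
    (φ : Chains K m n) {ξ : Chains K 0 m} (hξ : ξ ∈ chainsGE K d 0 m)
    (hm : (relations K 0 m).mkQ ξ ∈ preimage W m) : act φ ξ ∈ preimage W n := by
  obtain ⟨hx, hx'⟩ := mem_preimage.1 hm
  have hy : act φ ξ ∈ degreeGE K d 0 n :=
    degreeGE_anti (by omega) (act_mem_degreeGE (chainsGE_zero φ) hξ)
  exact mem_preimage.2 ⟨hy, hW m n ((relations K m n).mkQ φ) ⟨_, hx⟩ ⟨_, hy⟩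
    ⟨φ, ξ, rfl, rfl, (act_apply φ ξ).symm⟩ hx'⟩

theorem isSplitting_preimage (hd : d ≤ d') {F G : ∀ n, Submodule K (Subquotient K d d' n)}
    (hF : IsStable F) (hG : IsStable G) (h : ∀ n, IsCompl (F n) (G n)) :
    IsSplitting d d' (preimage F) (preimage G) where
  act_left φ _ := act_mem_preimage hF φ
  act_right φ _ := act_mem_preimage hG φ
  sup n := by
    refine le_antisymm (sup_le ?_ ?_) ?_
    · exact fun x hx => (mem_preimage.1 hx).1
    · exact fun x hx => (mem_preimage.1 hx).1
    · intro x hx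
      have htop : (Submodule.Quotient.mk ⟨x, hx⟩ : Subquotient K d d' n) ∈ F n ⊔ G n := by
        rw [(h n).sup_eq_top]
        exact Submodule.mem_top
      obtain ⟨u, hu, v, hv, huv⟩ := Submodule.mem_sup.1 htop
      obtain ⟨y, rfl⟩ := Submodule.Quotient.mk_surjective _ u
      have hxy : (Submodule.Quotient.mk (⟨x, hx⟩ - y) : Subquotient K d d' n) ∈ G n := by
        rw [Submodule.Quotient.mk_sub, ← huv, add_sub_cancel_left]
        exact hv
      rw [← add_sub_cancel y.1 x]
      exact Submodule.add_mem_sup (mem_preimage.2 ⟨y.2, hu⟩) (mem_preimage.2 ⟨_, hxy⟩)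
  inf n := by
    refine le_antisymm ?_ fun x hx => ?_
    · rintro x ⟨h1, h2⟩
      obtain ⟨hx, h1⟩ := mem_preimage.1 h1
      obtain ⟨_, h2⟩ := mem_preimage.1 h2
      exact mk_eq_zero_iff.1 (Submodule.disjoint_def.1 (h n).disjoint _ h1 h2)
    · have hx' : x ∈ degreeGE K d 0 n := degreeGE_anti hd hx
      have h0 : (Submodule.Quotient.mk ⟨x, hx'⟩ : Subquotient K d d' n) = 0 := mk_eq_zero_iff.2 hx
      exact ⟨mem_preimage.2 ⟨hx', h0 ▸ Submodule.zero_mem _⟩,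
        mem_preimage.2 ⟨hx', h0 ▸ Submodule.zero_mem _⟩⟩

theorem eq_bot_of_le_preimage {F G : ∀ n, Submodule K (Subquotient K d d' n)}
    (h : IsCompl (F n) (G n)) (hF : degreeGE K d 0 n ≤ preimage F n) : G n = ⊥ := by
  have htop : F n = ⊤ := by
    rw [eq_top_iff]
    intro x _
    obtain ⟨y, rfl⟩ := Submodule.Quotient.mk_surjective _ x
    exact (mem_preimage.1 (hF y.2)).2
  exact eq_bot_of_top_isCompl (htop ▸ h)

/-- The form that counts all chord diagrams with `d` chords is 1 on this diagram and vanishes in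
higher degree. This makes the quotient nonzero. -/
theorem chords_notMem_degreeGE (h : d < d') :
    cls K (JacobiDiagram.chords d) ∉ degreeGE K d' 0 (2 * d) := by
  intro hmem
  have h0 := chordForm_eq_zero h (P := fun _ => True) hmem
  rw [chordForm_cls, chordIndicator, if_pos] at h0
  · exact one_ne_zero h0
  · exact ⟨rfl, by simp [JacobiDiagram.chords, RawDiagram.chords], trivial⟩

end

end JacobiHandlebody

open JacobiHandlebody in
theorem mainTheorem5 (K : Type*) [Field K] [CharZero K] (d d' : ℕ) (h : d + 2 ≤ d') :
    JacobiHandlebody.IsIndecomposable K d d' := by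
  refine ⟨⟨2 * d, ?_⟩, fun F G hF hG hFG => ?_⟩
  · refine nontrivial_of_ne (Submodule.Quotient.mk
      ⟨cls K (JacobiDiagram.chords d), cls_mem_degreeGE (degree_chords d).ge⟩) 0 fun h0 => ?_
    exact chords_notMem_degreeGE (by omega) (mk_eq_zero_iff.1 h0)
  · rcases (isSplitting_preimage (by omega) hF hG hFG).le_or_le h with h1 | h1
    · exact Or.inr fun n => eq_bot_of_le_preimage (hFG n) (h1 n)
    · exact Or.inl fun n => eq_bot_of_le_preimage (hFG n).symm (h1 n)
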